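/- Let $v\in\ell^1(\mathbb Z^2,\mathbb R)$ satisfy $v(-x)=v(x)$ and $v(-x_2,x_1)=v(x_1,x_2)$, with Fourier transform $\hat v(k)=\sum_{x\in\mathbb Z^2}e^{-ik\cdot x}v(x)$, and let $\kappa>0$, $h_b\ge 0$. For $\varepsilon,U\ge 0$ let $H=H_{\varepsilon,U}$ be the Hamiltonian of one zero-spin fermion pair coupled to one boson, i.e. the bounded self-adjoint operator on the Hilbert space $\ell^2(\mathbb Z^2\times\mathbb Z^2;\mathbb C)\oplus\ell^2(\mathbb Z^2;\mathbb C)$ of pairs $(\mathfrak c,\mathfrak b)$ (pair wave function, boson wave function) given by $$H(\mathfrak c,\mathfrak b)=\bigl(T\mathfrak c+B^*\mathfrak b,\ B\mathfrak c+S\mathfrak b\bigr),$$ $$(T\mathfrak c)(x_\uparrow,x_\downarrow)=\varepsilon\Bigl(-\tfrac12\sum_{|z|=1}\bigl[\mathfrak c(x_\uparrow+z,x_\downarrow)+\mathfrak c(x_\uparrow,x_\downarrow+z)\bigr]+4\,\mathfrak c(x_\uparrow,x_\downarrow)\Bigr)+U\delta_{x_\uparrow,x_\downarrow}\mathfrak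 c(x_\uparrow,x_\downarrow),$$ $$(S\mathfrak b)(x)=\varepsilon h_b\Bigl(-\tfrac12\sum_{|z|=1}\mathfrak b(x+z)+2\,\mathfrak b(x)\Bigr),\qquad (B\mathfrak c)(x)=\sum_{y\in\mathbb Z^2}v(x-y)\sum_{|z|\le 1}e^{-\kappa|z|}\mathfrak c(y+z,y).$$ Let $E_0=\inf\sigma(H)$ and, for $\varrho>0$, let $\Xi_\varrho$ be the set of all $(\mathfrak c_t,\mathfrak b_t)\in C^1(\mathbb R)$ of norm one that solve $i\frac{d}{dt}(\mathfrak c_t,\mathfrak b_t)=H(\mathfrak c_t,\mathfrak b_t)$ and take values in the range of the spectral projection $\mathbf 1_{[E_0,E_0(1-\varrho)]}(H)$. Put $$\mathbf s_k(y)=\tfrac12\sum_{|z|=1}e^{ik\cdot z}\delta_{y,z},\qquad \mathfrak K_v=\Bigl\{k\in[-\pi,\pi)^2:\ |\hat v(k)|=\max_{q\in[-\pi,\pi)^2}|\hat v(q)|\Bigr\}.$$ **Theorem 3.3.** Assume that $\mathfrak K_v$ is finite and let $\eta>0$. There are $\varrho_0,\varepsilon_0,U_0,U_1>0$ such that for all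 $\varrho\in(0,\varrho_0]$, $\varepsilon\in(0,\varepsilon_0]$, $U\ge0$ and every $(\mathfrak c_t,\mathfrak b_t)\in\Xi_\varrho$ there is a family $\{f^{(k)}\}_{k\in\mathfrak K_v}\subset C(\mathbb R,\ell^2(\mathbb Z^2;\mathbb C))$ with the following properties. (s) If $U\le U_0$, then for all $t\in\mathbb R$ $$\sum_{x_\uparrow,x_\downarrow\in\mathbb Z^2}\Bigl|\mathfrak c_t(x_\uparrow,x_\downarrow)-\sum_{k\in\mathfrak K_v}\bigl\{\delta_{x_\uparrow,x_\downarrow}+2e^{-\kappa}\mathbf s_k(x_\uparrow-x_\downarrow)\bigr\}f^{(k)}_t(x_\uparrow)\Bigr|^2\le\eta .$$ (d) If $U\ge U_1$, then for all $t\in\mathbb R$ $$\sum_{x_\uparrow,x_\downarrow\in\mathbb Z^2}\Bigl|\mathfrak c_t(x_\uparrow,x_\downarrow)-\sum_{k\in\mathfrak K_v}\mathbf s_k(x_\uparrow-x_\downarrow)f^{(k)}_t(x_\uparrow)\Bigr|^2\le\eta .$$ -/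

import Mathlib

namespace BoundPair

noncomputable section

/-! ## Lattice and Hilbert spaces -/

/-- The square lattice `ℤ²`. -/
abbrev Lattice : Type := ℤ × ℤ

/-- The complex Hilbert space `ℓ²(I)` of square-summable functions on `I`. -/
abbrev EllTwo (I : Type) : Type := lp (fun _ : I => ℂ) 2

/-- The Hilbert space `ℓ²(ℤ² × ℤ²) × ℓ²(ℤ²)` (Hilbert direct sum) of the sector spanned by the states
of one fermion pair of zero total spin and by the states of one boson. An element is a pair `(c, b)`
where `c (x↑, x↓)` is the wave function of the fermion pair, the first argument being the
position of the spin-up fermion, and `b x` is the wave function of the boson. -/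
abbrev Sector : Type := WithLp 2 (EllTwo (Lattice × Lattice) × EllTwo Lattice)

/-- The four nearest neighbours of the origin, i.e. the `z ∈ ℤ²` with `|z| = 1`. -/
def neighbours : Finset Lattice := {(0, 1), (0, -1), (1, 0), (-1, 0)}

/-! ## Elementary operators on `ℓ²` -/

theorem memℓp_comp {I J : Type} (e : J ↪ I) (φ : EllTwo I) :
    Memℓp (E := fun _ : J => ℂ) (fun j => φ (e j)) 2 := by
  apply memℓp_gen
  exact ((lp.memℓp φ).summable (by norm_num)).comp_injective e.injective

/-- Composition with an injective map `e : J ↪ I`, as a bounded operator `ℓ²(I) → ℓ²(J)`: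
`(pull e φ) j = φ (e j)`. -/
def pull {I J : Type} (e : J ↪ I) : EllTwo I →L[ℂ] EllTwo J :=
  LinearMap.mkContinuous
    { toFun := fun φ => ⟨fun j => φ (e j), memℓp_comp e φ⟩
      map_add' := fun _ _ => rfl
      map_smul' := fun _ _ => rfl }
    1 (fun φ => by
      rw [one_mul]
      refine lp.norm_le_of_tsum_le (by norm_num) (norm_nonneg φ) ?_
      rw [lp.norm_rpow_eq_tsum (by norm_num) φ]
      exact tsum_comp_le_tsum_of_inj ((lp.memℓp φ).summable (by norm_num))
        (fun i => by positivity) e.injective)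

@[simp] theorem pull_apply {I J : Type} (e : J ↪ I) (φ : EllTwo I) (j : J) :
    pull e φ j = φ (e j) := rfl

/-- The translation `x ↦ x + z` of the lattice. -/
def shift (z : Lattice) : Lattice ↪ Lattice := (Equiv.addRight z).toEmbedding

/-- The translation `(x↑, x↓) ↦ (x↑ + z, x↓)` of the spin-up position. -/
def shiftUp (z : Lattice) : Lattice × Lattice ↪ Lattice × Lattice :=
  (shift z).prodMap (Function.Embedding.refl Lattice)

/-- The translation `(x↑, x↓) ↦ (x↑, x↓ + z)` of the spin-down position. -/
def shiftDown (z : Lattice) : Lattice × Lattice ↪ Lattice × Lattice :=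
  (Function.Embedding.refl Lattice).prodMap (shift z)

/-- The embedding `y ↦ (y + z, y)`. -/
def pairAt (z : Lattice) : Lattice ↪ Lattice × Lattice :=
  ⟨fun y => (y + z, y), fun _ _ h => congrArg Prod.snd h⟩

/-- Convolution with `v`: `(convolution v φ) x = ∑ z, v z * φ (x - z) = ∑ y, v (x - y) * φ y`.
The series of operators converges in norm for `v ∈ ℓ¹`. -/
def convolution (v : Lattice → ℝ) : EllTwo Lattice →L[ℂ] EllTwo Lattice :=
  ∑' z : Lattice, (v z : ℂ) • pull (shift (-z))

/-! ## The Hamiltonian -/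

/-- The fermionic part on the pair sector: nearest-neighbour hopping of both fermions,
`ε (-(1/2) ∑_{s, |x-y|=1} a*_{x,s} a_{y,s} + 2 ∑_{s,x} a*_{x,s} a_{x,s})`, plus the Hubbard repulsion
`U ∑_x n_{x,↑} n_{x,↓}` (the projection onto `x↑ = x↓`, multiplied by `U`). -/
def fermionPart (ε U : ℝ) : EllTwo (Lattice × Lattice) →L[ℂ] EllTwo (Lattice × Lattice) :=
  (ε : ℂ) • (-(1 / 2 : ℂ) • ∑ z ∈ neighbours, (pull (shiftUp z) + pull (shiftDown z))
      + (4 : ℂ) • ContinuousLinearMap.id ℂ (EllTwo (Lattice × Lattice)))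
    + (U : ℂ) • (ContinuousLinearMap.adjoint (pull (pairAt 0)) ∘L pull (pairAt 0))

/-- The bosonic part on the one-boson sector,
`ε (-(h/2) ∑_{|x-y|=1} b*_x b_y + 2 h ∑_x b*_x b_x)`. -/
def bosonPart (ε h : ℝ) : EllTwo Lattice →L[ℂ] EllTwo Lattice :=
  (ε : ℂ) • (-((h : ℂ) / 2) • ∑ z ∈ neighbours, pull (shift z)
      + (2 * (h : ℂ)) • ContinuousLinearMap.id ℂ (EllTwo Lattice))

/-- The map `c ↦ (y ↦ c_y c)` where `c_y = ∑_{|z| ≤ 1} exp(-κ|z|) a_{y+z,↑} a_{y,↓}` annihilates a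
fermion pair and `a_{x,↑} a_{y,↓} c = c (x, y)`. -/
def pairAnnihilation (κ : ℝ) : EllTwo (Lattice × Lattice) →L[ℂ] EllTwo Lattice :=
  pull (pairAt 0) + (Real.exp (-κ) : ℂ) • ∑ z ∈ neighbours, pull (pairAt z)

/-- The part `∑_{x,y} v (x - y) b*_x c_y` of the exchange interaction: it annihilates a fermion pair
and creates a boson. -/
def exchange (κ : ℝ) (v : Lattice → ℝ) : EllTwo (Lattice × Lattice) →L[ℂ] EllTwo Lattice :=
  convolution v ∘L pairAnnihilation κ

/-- The Hamiltonian of the sector of one fermion pair and one boson: in block form it is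
`[[fermionPart, exchange*], [exchange, bosonPart]]`. -/
def hamiltonian (ε U h κ : ℝ) (v : Lattice → ℝ) : Sector →L[ℂ] Sector :=
  let e := WithLp.prodContinuousLinearEquiv 2 ℂ (EllTwo (Lattice × Lattice)) (EllTwo Lattice)
  let p₁ := WithLp.fstL 2 ℂ (EllTwo (Lattice × Lattice)) (EllTwo Lattice)
  let p₂ := WithLp.sndL 2 ℂ (EllTwo (Lattice × Lattice)) (EllTwo Lattice)
  (e.symm : _ →L[ℂ] Sector) ∘L
    ((fermionPart ε U ∘L p₁ + ContinuousLinearMap.adjoint (exchange κ v) ∘L p₂).prod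
      (exchange κ v ∘L p₁ + bosonPart ε h ∘L p₂))

/-! ## Low-energy solutions of the Schrödinger equation -/

/-- For a bounded self-adjoint operator `A` and a closed set `S ⊆ ℝ`, this is the range of the
spectral projection `1_S(A)`: a vector `ψ` belongs to it iff the spectral measure of `A` at `ψ` is
carried by `S`, i.e. iff `f(A) ψ = 0` for every continuous `f` that vanishes on `S`. -/
def spectralSubspace {E : Type*} [NormedAddCommGroup E] [InnerProductSpace ℂ E] [CompleteSpace E]
    (A : E →L[ℂ] E) (S : Set ℝ) : Submodule ℂ E where
  carrier := {ψ | ∀ f : ℝ → ℝ, Continuous f → (∀ x ∈ S, f x = 0) →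
    cfc (p := IsSelfAdjoint) f A ψ = 0}
  add_mem' := fun ha hb f hf hS => by rw [map_add, ha f hf hS, hb f hf hS, add_zero]
  zero_mem' := fun f _ _ => map_zero _
  smul_mem' := fun c ψ h f hf hS => by rw [map_smul, h f hf hS, smul_zero]

/-- The bottom of the spectrum of a bounded self-adjoint operator. -/
def groundEnergy {E : Type*} [NormedAddCommGroup E] [InnerProductSpace ℂ E] [CompleteSpace E]
    (A : E →L[ℂ] E) : ℝ := sInf (spectrum ℝ A)

/-- The `C¹` solutions `ψ` of norm one of `i dψ/dt = A ψ` with values in the range of the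
spectral projection of `A` on `[E₀, E₀ (1 - ρ)]`, where `E₀` is the bottom of the spectrum of `A`. -/
def lowEnergySolutions (A : Sector →L[ℂ] Sector) (ρ : ℝ) : Set (ℝ → Sector) :=
  {ψ | ContDiff ℝ 1 ψ ∧ ∀ t : ℝ, Complex.I • deriv ψ t = A (ψ t) ∧
    ψ t ∈ spectralSubspace A (Set.Icc (groundEnergy A) (groundEnergy A * (1 - ρ))) ∧ ‖ψ t‖ = 1}

/-! ## Momentum space and orbitals -/

/-- The inner product `k · x` of a quasi-momentum and a lattice point. -/
def momentumDot (k : ℝ × ℝ) (x : Lattice) : ℝ := k.1 * x.1 + k.2 * x.2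

/-- The Brillouin zone `[-π, π)²`. -/
def brillouin : Set (ℝ × ℝ) := Set.Ico (-Real.pi) Real.pi ×ˢ Set.Ico (-Real.pi) Real.pi

/-- The Fourier transform `v̂(k) = ∑ x, exp(-i k·x) v x`. -/
def fourier (v : Lattice → ℝ) (k : ℝ × ℝ) : ℂ :=
  ∑' x : Lattice, Complex.exp (-Complex.I * momentumDot k x) * v x

/-- The set of the maximizers of `|v̂|` in the Brillouin zone. -/
def maximizers (v : Lattice → ℝ) : Set (ℝ × ℝ) :=
  {k | k ∈ brillouin ∧ IsMaxOn (fun q => ‖fourier v q‖) brillouin k}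

/-- The orbital `s_k(y) = (1/2) ∑_{|z|=1} exp(i k·z) δ_{y,z}`. -/
def orbital (k : ℝ × ℝ) (y : Lattice) : ℂ :=
  (1 / 2) * ∑ z ∈ neighbours, if y = z then Complex.exp (Complex.I * momentumDot k z) else 0

/-- `∑ p, |g p|² ≤ η`, where the series is required to converge. -/
def SqSumLE (g : Lattice × Lattice → ℂ) (η : ℝ) : Prop :=
  Summable (fun p => ‖g p‖ ^ 2) ∧ ∑' p, ‖g p‖ ^ 2 ≤ η

end

end BoundPair

namespace BoundPair

noncomputable section

open MeasureTheory UnitAddTorus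

open scoped ENNReal ComplexConjugate

/-! Write `V` for convolution with `v`, `M = ‖symbol v‖ = max |v̂|`, and `P = formFactor β a` with
`a = exp(-κ)`. Up to small errors the problem is governed by the off-diagonal operator with entries
`P* V` and `V P`: for weak repulsion `β = 1`, and for strong repulsion `β = 0`, because the equation
on the diagonal `x↑ = x↓` forces double occupancy to be `O(1/U)` (`reduced_equation_weak`,
`reduced_equation_strong`).

The five pair positions are orthogonal, so `P P* = N²` is a scalar, with `N² = β² + 4a²`. Trial
states give a ground energy `E` at most about `-N M` (`groundEnergy_hamiltonian_le`). A state in the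
spectral window satisfies `Hψ ≈ Eψ`. Eliminating the pair component leaves `E² b ≈ N² V² b`, hence
`V² b ≈ M² b` (`norm_gap_le`).

In Fourier space `M² - V²` is multiplication by `M² - v̂²`, which vanishes exactly on the finite set
of maximizers. So `b`, and with it `g = E⁻¹ V b`, is nearly a sum of pieces concentrated near the
maximizers (`exists_localization`). The pair component is `c ≈ P* g`, in which `g` is evaluated at
`x↓`; on the piece near `k`, moving the argument to `x↑` costs only a phase `exp(i k·z)`, and this
produces the orbital `s_k` (`exists_pairState_approximation`).

Time plays no dynamical role: the estimate holds at each `t`, and the centre-of-mass functions are a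
fixed bounded linear image of the state, hence continuous in `t`. -/

/-! ### Fourier series and multiplication operators on the torus -/

/-- The Haar probability measure on the circle `ℝ / ℤ` as its volume. -/
@[reducible] def unitCircleMeasureSpace : MeasureSpace UnitAddCircle := ⟨AddCircle.haarAddCircle⟩

attribute [local instance] unitCircleMeasureSpace

theorem unitCircle_isAddHaar : Measure.IsAddHaarMeasure (volume : Measure UnitAddCircle) :=
  inferInstanceAs (Measure.IsAddHaarMeasure AddCircle.haarAddCircle)

theorem unitCircle_isProbability : IsProbabilityMeasure (volume : Measure UnitAddCircle) :=
  inferInstanceAs (IsProbabilityMeasure AddCircle.haarAddCircle)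

attribute [local instance] unitCircle_isAddHaar unitCircle_isProbability

/-- The two-dimensional torus `(ℝ / ℤ)²`. -/
abbrev Torus : Type := UnitAddTorus (Fin 2)

/-- The space `L²` of the torus. -/
abbrev TorusLp (p : ℝ≥0∞) : Type := Lp ℂ p (volume : Measure Torus)

/-- The character `t ↦ exp(2πi x·t)` of the torus. -/
def character (x : Lattice) : C(Torus, ℂ) := mFourier ![x.1, x.2]

theorem character_add (x y : Lattice) : character (x + y) = character x * character y := by
  ext t
  rw [ContinuousMap.mul_apply, character, character, character, ← mFourier_add]
  simp

theorem conj_character (x : Lattice) (t : Torus) :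
    conj (character x t) = character (-x) t := by
  rw [character, character, ← mFourier_neg]
  simp

theorem norm_character (x : Lattice) : ‖character x‖ = 1 := mFourier_norm

/-- The index map from the lattice to the frequencies of the torus. -/
def frequency : Lattice ≃ (Fin 2 → ℤ) := (finTwoArrowEquiv ℤ).symm

/-- The Fourier basis of `L²` of the torus, indexed by the lattice. -/
def torusBasis : HilbertBasis Lattice ℂ (TorusLp 2) :=
  HilbertBasis.mk (v := fun x => mFourierLp 2 (frequency x))
    (orthonormal_mFourier.comp _ frequency.injective) (by
      have h : Set.range (fun x => mFourierLp (d := Fin 2) 2 (frequency x))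
          = Set.range (mFourierLp (d := Fin 2) 2) :=
        frequency.surjective.range_comp (mFourierLp (d := Fin 2) 2)
      rw [h]
      exact (span_mFourierLp_closure_eq_top (by simp)).ge)

theorem torusBasis_apply (x : Lattice) :
    torusBasis x = ContinuousMap.toLp 2 volume ℂ (character x) := by
  rw [torusBasis, HilbertBasis.coe_mk]
  rfl

/-- Multiplication by a continuous function on `L²` of the torus. -/
def torusMul : C(Torus, ℂ) →L[ℂ] TorusLp 2 →L[ℂ] TorusLp 2 :=
  (ContinuousLinearMap.mul ℂ ℂ).holderL volume ∞ 2 2 ∘L ContinuousMap.toLp ∞ volume ℂ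

theorem coeFn_torusMul (f : C(Torus, ℂ)) (g : TorusLp 2) :
    torusMul f g =ᵐ[volume] fun t => f t * g t := by
  have h1 := (ContinuousLinearMap.mul ℂ ℂ).coeFn_holder (r := 2)
    (ContinuousMap.toLp ∞ (volume : Measure Torus) ℂ f) g
  have h2 := ContinuousMap.coeFn_toLp (p := ∞) (𝕜 := ℂ) (volume : Measure Torus) f
  filter_upwards [h1, h2] with t ht1 ht2
  refine ht1.trans ?_
  rw [ht2]
  rfl

theorem norm_torusMul_apply_le (f : C(Torus, ℂ)) (g : TorusLp 2) :
    ‖torusMul f g‖ ≤ ‖f‖ * ‖g‖ := by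
  refine Lp.norm_le_mul_norm_of_ae_le_mul ?_
  filter_upwards [coeFn_torusMul f g] with t ht
  rw [ht, norm_mul]
  exact mul_le_mul_of_nonneg_right (f.norm_coe_le_norm t) (norm_nonneg _)

theorem torusMul_mul (f₁ f₂ : C(Torus, ℂ)) (g : TorusLp 2) :
    torusMul (f₁ * f₂) g = torusMul f₁ (torusMul f₂ g) := by
  refine Lp.ext ?_
  filter_upwards [coeFn_torusMul (f₁ * f₂) g, coeFn_torusMul f₁ (torusMul f₂ g),
    coeFn_torusMul f₂ g] with t h1 h2 h3
  rw [h1, h2, h3, ContinuousMap.mul_apply, mul_assoc]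

theorem torusMul_one (g : TorusLp 2) : torusMul 1 g = g := by
  refine Lp.ext ?_
  filter_upwards [coeFn_torusMul 1 g] with t h1
  rw [h1, ContinuousMap.one_apply, one_mul]

theorem torusMul_toLp (f g : C(Torus, ℂ)) :
    torusMul f (ContinuousMap.toLp 2 volume ℂ g) = ContinuousMap.toLp 2 volume ℂ (f * g) := by
  refine Lp.ext ?_
  filter_upwards [coeFn_torusMul f (ContinuousMap.toLp 2 volume ℂ g),
    ContinuousMap.coeFn_toLp (p := 2) (𝕜 := ℂ) (volume : Measure Torus) g,
    ContinuousMap.coeFn_toLp (p := 2) (𝕜 := ℂ) (volume : Measure Torus) (f * g)] with t h1 h2 h3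
  rw [h1, h2, h3, ContinuousMap.mul_apply]

/-- Acting on the constant function `1` recovers `f` as an `L²` class, and a continuous function is
determined by that class. -/
theorem torusMul_injective : Function.Injective torusMul := by
  intro f₁ f₂ h
  have h' := congrArg (fun A => A (ContinuousMap.toLp 2 volume ℂ (1 : C(Torus, ℂ)))) h
  simp only [torusMul_toLp, mul_one] at h'
  exact ContinuousMap.toLp_injective (p := 2) (𝕜 := ℂ) (volume : Measure Torus) h'

theorem repr_torusMul_character (z : Lattice) (g : TorusLp 2) (x : Lattice) :
    torusBasis.repr (torusMul (character z) g) x = torusBasis.repr g (x - z) := by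
  rw [HilbertBasis.repr_apply_apply, HilbertBasis.repr_apply_apply, torusBasis_apply,
    torusBasis_apply, L2.inner_def, L2.inner_def]
  refine integral_congr_ae ?_
  filter_upwards [coeFn_torusMul (character z) g,
    ContinuousMap.coeFn_toLp (p := 2) (𝕜 := ℂ) (volume : Measure Torus) (character x),
    ContinuousMap.coeFn_toLp (p := 2) (𝕜 := ℂ) (volume : Measure Torus) (character (x - z))]
    with t h1 h2 h3
  rw [h1, h2, h3, RCLike.inner_apply, RCLike.inner_apply, conj_character, conj_character,
    show -(x - z) = z + -x by abel, character_add, ContinuousMap.mul_apply]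
  ring

/-! ### Fourier multipliers on the lattice -/

/-- The operator on `ℓ²(ℤ²)` that is multiplication by `f` in the Fourier representation. -/
def multiplier : C(Torus, ℂ) →ₗ[ℂ] EllTwo Lattice →L[ℂ] EllTwo Lattice where
  toFun f := (torusBasis.repr : TorusLp 2 →L[ℂ] EllTwo Lattice) ∘L torusMul f ∘L
    (torusBasis.repr.symm : EllTwo Lattice →L[ℂ] TorusLp 2)
  map_add' f₁ f₂ := by
    ext1 φ
    simp
  map_smul' c f := by
    ext1 φ
    simp

theorem multiplier_apply (f : C(Torus, ℂ)) (φ : EllTwo Lattice) :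
    multiplier f φ = torusBasis.repr (torusMul f (torusBasis.repr.symm φ)) := rfl

theorem norm_multiplier_apply_le (f : C(Torus, ℂ)) (φ : EllTwo Lattice) :
    ‖multiplier f φ‖ ≤ ‖f‖ * ‖φ‖ := by
  rw [multiplier_apply, LinearIsometryEquiv.norm_map]
  refine (norm_torusMul_apply_le _ _).trans_eq ?_
  rw [LinearIsometryEquiv.norm_map]

theorem norm_multiplier_le (f : C(Torus, ℂ)) : ‖multiplier f‖ ≤ ‖f‖ :=
  ContinuousLinearMap.opNorm_le_bound _ (norm_nonneg _) (norm_multiplier_apply_le f)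

theorem multiplier_mul (f₁ f₂ : C(Torus, ℂ)) :
    multiplier (f₁ * f₂) = multiplier f₁ ∘L multiplier f₂ := by
  ext1 φ
  simp [multiplier_apply, torusMul_mul]

theorem multiplier_mul_apply (f₁ f₂ : C(Torus, ℂ)) (φ : EllTwo Lattice) :
    multiplier (f₁ * f₂) φ = multiplier f₁ (multiplier f₂ φ) := by
  rw [multiplier_mul]
  rfl

theorem multiplier_one_apply (φ : EllTwo Lattice) : multiplier 1 φ = φ := by
  simp [multiplier_apply, torusMul_one]

theorem multiplier_injective : Function.Injective multiplier := by
  intro f₁ f₂ h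
  refine torusMul_injective ?_
  ext1 g
  have h' := congrArg (fun A : EllTwo Lattice →L[ℂ] EllTwo Lattice => A (torusBasis.repr g)) h
  simpa [multiplier_apply] using h'

theorem multiplier_character (z : Lattice) : multiplier (character z) = pull (shift (-z)) := by
  ext φ x
  rw [multiplier_apply, repr_torusMul_character, LinearIsometryEquiv.apply_symm_apply, pull_apply]
  rfl

/-- The multiplier as a bounded operator between algebras. -/
def multiplierL : C(Torus, ℂ) →L[ℂ] EllTwo Lattice →L[ℂ] EllTwo Lattice :=
  multiplier.mkContinuous 1 fun f => by simpa using norm_multiplier_le f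

/-- The symbol `∑ x, v x exp(2πi x·t)` of the convolution with `v`. -/
def symbol (v : Lattice → ℝ) : C(Torus, ℂ) := ∑' x : Lattice, (v x : ℂ) • character x

theorem summable_symbol {v : Lattice → ℝ} (hv : Summable fun x => |v x|) :
    Summable fun x : Lattice => (v x : ℂ) • character x :=
  Summable.of_norm (by simpa [norm_smul, norm_character] using hv)

theorem multiplier_symbol {v : Lattice → ℝ} (hv : Summable fun x => |v x|) :
    multiplier (symbol v) = convolution v := by
  change multiplierL (symbol v) = _
  rw [symbol, multiplierL.map_tsum (summable_symbol hv), convolution]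
  refine tsum_congr fun x => ?_
  rw [map_smul, ← multiplier_character]
  rfl

theorem symbol_apply {v : Lattice → ℝ} (hv : Summable fun x => |v x|) (t : Torus) :
    symbol v t = ∑' x : Lattice, (v x : ℂ) * character x t := by
  rw [symbol, ← ContinuousMap.tsum_apply (summable_symbol hv)]
  simp

/-! ### Quasi-momenta as points of the torus, and the maximizers -/

/-- The point of the torus given by the quasi-momentum `k`. -/
def torusPoint (k : ℝ × ℝ) : Torus :=
  ![((k.1 / (2 * Real.pi) : ℝ) : UnitAddCircle), ((k.2 / (2 * Real.pi) : ℝ) : UnitAddCircle)]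

theorem character_torusPoint (x : Lattice) (k : ℝ × ℝ) :
    character x (torusPoint k) = Complex.exp (Complex.I * momentumDot k x) := by
  have hπ : (Real.pi : ℂ) ≠ 0 := by exact_mod_cast Real.pi_ne_zero
  simp only [character, UnitAddTorus.mFourier, ContinuousMap.coe_mk, Fin.prod_univ_two, torusPoint,
    Matrix.cons_val_zero, Matrix.cons_val_one, fourier_coe_apply, momentumDot]
  rw [← Complex.exp_add]
  congr 1
  push_cast
  field_simp

/-- The two sides use opposite signs in the exponent; the evenness of `v` reconciles them. -/
theorem symbol_torusPoint {v : Lattice → ℝ} (hv : Summable fun x => |v x|)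
    (hv_symm : ∀ x, v (-x) = v x) (k : ℝ × ℝ) : symbol v (torusPoint k) = fourier v k := by
  rw [symbol_apply hv, fourier, ← (Equiv.neg Lattice).tsum_eq]
  refine tsum_congr fun x => ?_
  rw [Equiv.neg_apply, hv_symm, character_torusPoint, mul_comm]
  congr 2
  simp only [momentumDot, Prod.fst_neg, Prod.snd_neg]
  push_cast
  ring

theorem exists_brillouin_coe_eq (t : UnitAddCircle) :
    ∃ x ∈ Set.Ico (-Real.pi) Real.pi, ((x / (2 * Real.pi) : ℝ) : UnitAddCircle) = t := by
  obtain ⟨⟨y, hy⟩, rfl⟩ := (AddCircle.equivIco (1 : ℝ) (-(1 / 2))).symm.surjective t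
  have hπ := Real.pi_pos
  refine ⟨2 * Real.pi * y, ⟨?_, ?_⟩, ?_⟩
  · nlinarith [hy.1]
  · nlinarith [hy.2]
  · rw [mul_div_cancel_left₀ _ (by positivity)]
    rfl

theorem brillouin_coe_injOn :
    Set.InjOn (fun x : ℝ => ((x / (2 * Real.pi) : ℝ) : UnitAddCircle))
      (Set.Ico (-Real.pi) Real.pi) := by
  intro x hx y hy h
  have hπ := Real.pi_pos
  have hmem : ∀ x ∈ Set.Ico (-Real.pi) Real.pi,
      x / (2 * Real.pi) ∈ Set.Ico (-(1 / 2) : ℝ) (-(1 / 2) + 1) := by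
    intro x hx
    constructor
    · rw [le_div_iff₀ (by positivity)]
      linarith [hx.1]
    · rw [div_lt_iff₀ (by positivity)]
      linarith [hx.2]
  have h' := (AddCircle.coe_eq_coe_iff_of_mem_Ico (hmem x hx) (hmem y hy)).1 h
  field_simp at h'
  exact h'

theorem exists_torusPoint_eq (t : Torus) : ∃ k ∈ brillouin, torusPoint k = t := by
  obtain ⟨x, hx, hx'⟩ := exists_brillouin_coe_eq (t 0)
  obtain ⟨y, hy, hy'⟩ := exists_brillouin_coe_eq (t 1)
  refine ⟨(x, y), ⟨hx, hy⟩, ?_⟩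
  ext i
  fin_cases i
  · exact hx'
  · exact hy'

theorem torusPoint_injOn : Set.InjOn torusPoint brillouin := by
  intro k hk q hq h
  exact Prod.ext (brillouin_coe_injOn hk.1 hq.1 (congrFun h 0))
    (brillouin_coe_injOn hk.2 hq.2 (congrFun h 1))

/-- The Brillouin zone covers the torus, so the maximum over the zone is the sup norm of the symbol.
-/
theorem mem_maximizers_iff {v : Lattice → ℝ} (hv : Summable fun x => |v x|)
    (hv_symm : ∀ x, v (-x) = v x) {k : ℝ × ℝ} (hk : k ∈ brillouin) :
    k ∈ maximizers v ↔ ‖symbol v (torusPoint k)‖ = ‖symbol v‖ := by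
  simp only [maximizers, Set.mem_ofPred_eq, hk, true_and, isMaxOn_iff,
    ← symbol_torusPoint hv hv_symm]
  constructor
  · intro h
    refine le_antisymm ((symbol v).norm_coe_le_norm _) ?_
    refine ((symbol v).norm_le (norm_nonneg _)).2 fun t => ?_
    obtain ⟨q, hq, rfl⟩ := exists_torusPoint_eq t
    exact h q hq
  · intro h q _
    rw [h]
    exact (symbol v).norm_coe_le_norm _

theorem brillouin_infinite : brillouin.Infinite := by
  have hπ := Real.pi_pos
  exact Set.Infinite.prod_left (Set.Ico_infinite (by linarith))
    ⟨0, by constructor <;> simp [hπ, hπ.le]⟩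

/-- If the symbol vanished identically, every point of the infinite Brillouin zone would be a
maximizer. -/
theorem norm_symbol_pos {v : Lattice → ℝ} (hv : Summable fun x => |v x|)
    (hv_symm : ∀ x, v (-x) = v x) (hK : (maximizers v).Finite) : 0 < ‖symbol v‖ := by
  by_contra hM
  have hM' : ‖symbol v‖ = 0 := le_antisymm (not_lt.1 hM) (norm_nonneg _)
  refine brillouin_infinite (hK.subset fun k hk => ?_)
  rw [mem_maximizers_iff hv hv_symm hk, hM']
  exact le_antisymm (hM' ▸ (symbol v).norm_coe_le_norm _) (norm_nonneg _)

theorem conj_symbol {v : Lattice → ℝ} (hv : Summable fun x => |v x|)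
    (hv_symm : ∀ x, v (-x) = v x) (t : Torus) : conj (symbol v t) = symbol v t := by
  rw [symbol_apply hv, Complex.conj_tsum, ← (Equiv.neg Lattice).tsum_eq]
  refine tsum_congr fun x => ?_
  rw [map_mul, conj_character, Equiv.neg_apply, hv_symm, neg_neg, Complex.conj_ofReal]

/-! ### Localization in momentum space -/

/-- A function that vanishes on the zeros of `w ≥ 0` is controlled by `w` up to a small error. -/
theorem exists_norm_le_add_mul {u : C(Torus, ℂ)} {w : C(Torus, ℝ)} (hw : ∀ t, 0 ≤ w t)
    (huw : ∀ t, w t = 0 → u t = 0) {δ : ℝ} (hδ : 0 < δ) :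
    ∃ C > 0, ∀ t, ‖u t‖ ≤ δ + C * w t := by
  have hc : IsCompact {t | δ ≤ ‖u t‖} :=
    (isClosed_le continuous_const (by fun_prop)).isCompact
  rcases Set.eq_empty_or_nonempty {t | δ ≤ ‖u t‖} with he | hne
  · refine ⟨1, one_pos, fun t => ?_⟩
    have : t ∉ {t | δ ≤ ‖u t‖} := by simp [he]
    have h1 : ‖u t‖ < δ := by simpa using this
    linarith [hw t]
  -- On the compact set `δ ≤ |u|` the function `w` has no zero, so its minimum `w s` there is
  -- positive and `C = ‖u‖ / w s` works.
  · obtain ⟨s, hs, hmin⟩ := hc.exists_isMinOn hne w.continuous.continuousOn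
    have hs0 : 0 < w s := by
      refine lt_of_le_of_ne (hw s) fun h => ?_
      have h0 : δ ≤ ‖u s‖ := hs
      rw [huw s h.symm, norm_zero] at h0
      linarith
    have hu : 0 < ‖u‖ := lt_of_lt_of_le (lt_of_lt_of_le hδ hs) (u.norm_coe_le_norm s)
    refine ⟨‖u‖ / w s, by positivity, fun t => ?_⟩
    by_cases ht : δ ≤ ‖u t‖
    · have h1 : w s ≤ w t := hmin ht
      have h2 : ‖u‖ ≤ ‖u‖ / w s * w t := by
        rw [div_mul_eq_mul_div, le_div_iff₀ hs0]
        exact mul_le_mul_of_nonneg_left h1 hu.le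
      linarith [u.norm_coe_le_norm t]
    · have h2 : 0 ≤ ‖u‖ / w s * w t := mul_nonneg (by positivity) (hw t)
      linarith

/-- The complexification of a real continuous function. -/
def complexify (w : C(Torus, ℝ)) : C(Torus, ℂ) := ⟨fun t => (w t : ℂ), by fun_prop⟩

@[simp] theorem complexify_apply (w : C(Torus, ℝ)) (t : Torus) : complexify w t = (w t : ℂ) := rfl

/-- Pointwise domination passes to operators by factoring `u = p (δ + C w)` with `‖p‖ ≤ 1`. -/
theorem norm_multiplier_le_of_norm_le {u : C(Torus, ℂ)} {w : C(Torus, ℝ)} {δ C : ℝ} (hδ : 0 < δ)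
    (hC : 0 ≤ C) (hw : ∀ t, 0 ≤ w t) (h : ∀ t, ‖u t‖ ≤ δ + C * w t) (g : EllTwo Lattice) :
    ‖multiplier u g‖ ≤ δ * ‖g‖ + C * ‖multiplier (complexify w) g‖ := by
  have hpos : ∀ t, 0 < δ + C * w t := fun t => by
    have := mul_nonneg hC (hw t)
    linarith
  have hne : ∀ t, (δ : ℂ) + C * w t ≠ 0 := fun t => by exact_mod_cast (hpos t).ne'
  let p : C(Torus, ℂ) := ⟨fun t => u t / (δ + C * w t), by fun_prop (disch := exact hne)⟩
  have hp : ‖p‖ ≤ 1 := by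
    refine (ContinuousMap.norm_le _ zero_le_one).2 fun t => ?_
    have h1 : ‖(δ : ℂ) + C * w t‖ = δ + C * w t := by
      rw [← Complex.ofReal_mul, ← Complex.ofReal_add, Complex.norm_real, Real.norm_eq_abs,
        abs_of_pos (hpos t)]
    change ‖u t / (δ + C * w t)‖ ≤ 1
    rw [norm_div, h1, div_le_one (hpos t)]
    exact h t
  have hu : u = p * ((δ : ℂ) • 1 + (C : ℂ) • complexify w) := by
    ext t
    change u t = u t / (δ + C * w t) * (δ * 1 + C * w t)
    rw [mul_one, div_mul_cancel₀ _ (hne t)]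
  have h1 : multiplier ((δ : ℂ) • 1 + (C : ℂ) • complexify w) g
      = (δ : ℂ) • g + (C : ℂ) • multiplier (complexify w) g := by
    rw [map_add, map_smul, map_smul, add_apply, smul_apply, smul_apply, multiplier_one_apply]
  rw [hu, multiplier_mul_apply, h1]
  refine (norm_multiplier_apply_le _ _).trans ?_
  refine (mul_le_of_le_one_left (norm_nonneg _) hp).trans ((norm_add_le _ _).trans_eq ?_)
  rw [norm_smul, norm_smul, Complex.norm_real, Complex.norm_real, Real.norm_eq_abs,
    Real.norm_eq_abs, abs_of_pos hδ, abs_of_nonneg hC]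

/-- Near each point `s` of a finite set there is a bump function that vanishes at the other points
and on whose support the characters are almost constant. -/
theorem exists_bump (F : Finset Torus) (N : Finset Lattice) (s : Torus) {δ : ℝ} (hδ : 0 < δ) :
    ∃ θ : C(Torus, ℂ), θ s = 1 ∧ (∀ s' ∈ F, s' ≠ s → θ s' = 0) ∧
      ∀ z ∈ N, ‖(1 - character z s • character (-z)) * θ‖ ≤ δ := by
  let O : Set Torus := {t | t ∉ F.erase s} ∩
    ⋂ z ∈ N, {t | ‖(1 - character z s • character (-z)) t‖ < δ}
  have hO : IsOpen O := by
    refine IsOpen.inter ((F.erase s).finite_toSet.isClosed.isOpen_compl) ?_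
    refine isOpen_biInter_finset fun z _ => ?_
    exact isOpen_lt (by fun_prop) continuous_const
  have hs : s ∈ O := by
    refine ⟨by simp, ?_⟩
    simp only [Set.mem_iInter, Set.mem_ofPred_eq]
    intro z _
    have : character z s * character (-z) s = 1 := by
      rw [← ContinuousMap.mul_apply, ← character_add, add_neg_cancel]
      simp [character, UnitAddTorus.mFourier]
    simpa [this] using hδ
  obtain ⟨f, hf0, hf1, hf⟩ := exists_continuous_zero_one_of_isClosed hO.isClosed_compl
    (isClosed_singleton (x := s)) (by simpa using hs)
  refine ⟨complexify f, by simp [hf1 rfl], fun s' hs' hne => ?_, fun z hz => ?_⟩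
  · have : s' ∈ Oᶜ := fun h => h.1 (Finset.mem_erase.2 ⟨hne, hs'⟩)
    simp [hf0 this]
  · refine (ContinuousMap.norm_le _ hδ.le).2 fun t => ?_
    rw [ContinuousMap.mul_apply, norm_mul, complexify_apply, Complex.norm_real, Real.norm_eq_abs,
      abs_of_nonneg (hf t).1]
    by_cases ht : t ∈ O
    · have h1 := ht.2
      simp only [Set.mem_iInter, Set.mem_ofPred_eq] at h1
      exact (mul_le_of_le_one_right (norm_nonneg _) (hf t).2).trans (h1 z hz).le
    · rw [hf0 ht]
      simpa using hδ.le

theorem multiplier_gap_apply {v : Lattice → ℝ} (hv : Summable fun x => |v x|)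
    {w : C(Torus, ℝ)} (hw : ∀ t, (w t : ℂ) = ‖symbol v‖ ^ 2 - symbol v t * symbol v t)
    (g : EllTwo Lattice) : multiplier (complexify w) g
      = ((‖symbol v‖ ^ 2 : ℝ) : ℂ) • g - convolution v (convolution v g) := by
  have h : complexify w = ((‖symbol v‖ ^ 2 : ℝ) : ℂ) • 1 - symbol v * symbol v := by
    ext t
    simp [hw]
  rw [h, map_sub, map_smul, sub_apply, smul_apply,
    multiplier_one_apply, multiplier_mul_apply, multiplier_symbol hv]

/-- Vectors on which the convolution with `v` has almost its maximal modulus are almost sums of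
vectors whose momenta are close to the maximizers. -/
theorem exists_localization {v : Lattice → ℝ} (hv : Summable fun x => |v x|)
    (hv_symm : ∀ x, v (-x) = v x) (hK : (maximizers v).Finite) {δ : ℝ} (hδ : 0 < δ) :
    ∃ C > 0, ∃ L : ℝ × ℝ → EllTwo Lattice →L[ℂ] EllTwo Lattice,
      (∀ g, ‖g - ∑ k ∈ hK.toFinset, L k g‖
        ≤ δ * ‖g‖ + C * ‖((‖symbol v‖ ^ 2 : ℝ) : ℂ) • g - convolution v (convolution v g)‖) ∧
      ∀ k, ∀ z ∈ neighbours, ∀ g, ‖L k g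
        - Complex.exp (Complex.I * momentumDot k z) • pull (shift z) (L k g)‖ ≤ δ * ‖g‖ := by
  have hb := fun k : ℝ × ℝ =>
    exists_bump (hK.toFinset.image torusPoint) neighbours (torusPoint k) hδ
  choose θ hθ1 hθ0 hθ using hb
  -- As `v` is even, its symbol is real and `|v̂|² = v̂²`; thus `w` is the symbol of `M² - V²`, with
  -- zeros exactly at the maximizers.
  let w : C(Torus, ℝ) := ⟨fun t => ‖symbol v‖ ^ 2 - ‖symbol v t‖ ^ 2, by fun_prop⟩
  have hw : ∀ t, 0 ≤ w t := fun t =>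
    sub_nonneg.2 (pow_le_pow_left₀ (norm_nonneg _) ((symbol v).norm_coe_le_norm t) 2)
  have hw' : ∀ t, (w t : ℂ) = ‖symbol v‖ ^ 2 - symbol v t * symbol v t := by
    intro t
    have h1 : symbol v t * symbol v t = ‖symbol v t‖ ^ 2 := by
      nth_rewrite 2 [← conj_symbol hv hv_symm t]
      exact Complex.mul_conj' _
    rw [h1]
    change ((‖symbol v‖ ^ 2 - ‖symbol v t‖ ^ 2 : ℝ) : ℂ) = _
    push_cast
    rfl
  obtain ⟨C, hC, hCu⟩ := exists_norm_le_add_mul (u := 1 - ∑ k ∈ hK.toFinset, θ k) hw (by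
    intro t ht
    obtain ⟨k, hk, rfl⟩ := exists_torusPoint_eq t
    have hkm : k ∈ maximizers v := by
      rw [mem_maximizers_iff hv hv_symm hk]
      have h2 : ‖symbol v‖ ^ 2 - ‖symbol v (torusPoint k)‖ ^ 2 = 0 := ht
      exact (pow_left_inj₀ (norm_nonneg _) (norm_nonneg _) two_ne_zero).1 (by linarith)
    -- The supports of the bumps may overlap: only the values at the maximizers matter, where one
    -- bump is `1` and the others vanish.
    have hsum : ∑ q ∈ hK.toFinset, θ q (torusPoint k) = 1 := by
      rw [Finset.sum_eq_single_of_mem k (hK.mem_toFinset.2 hkm), hθ1]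
      intro q hq hqk
      refine hθ0 q _ (Finset.mem_image_of_mem _ (hK.mem_toFinset.2 hkm)) fun h => hqk ?_
      exact (torusPoint_injOn hk (hK.mem_toFinset.1 hq).1 h).symm
    rw [ContinuousMap.sub_apply, ContinuousMap.sum_apply, hsum, ContinuousMap.one_apply, sub_self])
    hδ
  refine ⟨C, hC, fun k => multiplier (θ k), fun g => ?_, fun k z hz g => ?_⟩
  · have h1 := norm_multiplier_le_of_norm_le hδ hC.le hw hCu g
    rw [multiplier_gap_apply hv hw', map_sub, map_sum, sub_apply,
      multiplier_one_apply, sum_apply] at h1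
    exact h1
  · have h1 : multiplier (θ k) g
        - Complex.exp (Complex.I * momentumDot k z) • pull (shift z) (multiplier (θ k) g)
        = multiplier ((1 - character z (torusPoint k) • character (-z)) * θ k) g := by
      rw [multiplier_mul_apply, map_sub, map_smul, multiplier_character, neg_neg,
        sub_apply, smul_apply, multiplier_one_apply,
        character_torusPoint]
    rw [h1]
    exact (norm_multiplier_apply_le _ _).trans
      (mul_le_mul_of_nonneg_right (hθ k z hz) (norm_nonneg _))

/-! ### The norm of the convolution operator -/

theorem norm_convolution_apply_le {v : Lattice → ℝ} (hv : Summable fun x => |v x|)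
    (g : EllTwo Lattice) : ‖convolution v g‖ ≤ ‖symbol v‖ * ‖g‖ := by
  rw [← multiplier_symbol hv]
  exact norm_multiplier_apply_le _ _

/-- The convolution with `v` attains the supremum of its symbol approximately. -/
theorem exists_le_norm_convolution {v : Lattice → ℝ} (hv : Summable fun x => |v x|)
    {l : ℝ} (hl : 0 < l) (hlM : l < ‖symbol v‖) :
    ∃ b : EllTwo Lattice, b ≠ 0 ∧ l * ‖b‖ ≤ ‖convolution v b‖ := by
  obtain ⟨t₀, ht₀⟩ : ∃ t, l < ‖symbol v t‖ := by
    by_contra! h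
    exact absurd (((symbol v).norm_le hl.le).2 h) (not_le.2 hlM)
  -- `u` is a continuous cutoff to the region `|v̂| > l`.
  let u : C(Torus, ℝ) := ⟨fun t => max 0 (‖symbol v t‖ - l), by fun_prop⟩
  have hmax : ∀ t, 0 < max ‖symbol v t‖ l := fun t => lt_max_of_lt_right hl
  have hne : ∀ t, ((max ‖symbol v t‖ l : ℝ) : ℂ) ^ 2 ≠ 0 := fun t =>
    pow_ne_zero 2 (by exact_mod_cast (hmax t).ne')
  -- `p` equals `l / v̂` on the support of `u`; the maximum keeps it continuous and bounded by `1`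
  -- elsewhere.
  let p : C(Torus, ℂ) := ⟨fun t => l * conj (symbol v t) / ((max ‖symbol v t‖ l : ℝ) : ℂ) ^ 2, by
    fun_prop (disch := exact hne)⟩
  have hp : ‖p‖ ≤ 1 := by
    refine (ContinuousMap.norm_le _ zero_le_one).2 fun t => ?_
    change ‖l * conj (symbol v t) / ((max ‖symbol v t‖ l : ℝ) : ℂ) ^ 2‖ ≤ 1
    rw [norm_div, norm_mul, norm_pow, RCLike.norm_conj, Complex.norm_real, Complex.norm_real,
      Real.norm_of_nonneg hl.le, Real.norm_of_nonneg (hmax t).le, sq,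
      div_le_one (mul_pos (hmax t) (hmax t))]
    exact mul_le_mul (le_max_right _ _) (le_max_left _ _) (norm_nonneg _) (hmax t).le
  have hpu : p * (symbol v * complexify u) = (l : ℂ) • complexify u := by
    ext t
    change l * conj (symbol v t) / ((max ‖symbol v t‖ l : ℝ) : ℂ) ^ 2
      * (symbol v t * ((max 0 (‖symbol v t‖ - l) : ℝ) : ℂ))
      = l * ((max 0 (‖symbol v t‖ - l) : ℝ) : ℂ)
    rcases le_total ‖symbol v t‖ l with h | h
    · rw [max_eq_left (sub_nonpos.2 h)]
      simp
    · have h2 := hne t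
      rw [max_eq_left h] at h2 ⊢
      rw [div_mul_eq_mul_div, div_eq_iff h2, ← Complex.mul_conj']
      ring
  have hu : multiplier (complexify u) ≠ 0 := by
    intro h
    rw [← map_zero multiplier] at h
    have h1 := congrArg (fun f : C(Torus, ℂ) => f t₀) (multiplier_injective h)
    have h2 : ((max 0 (‖symbol v t₀‖ - l) : ℝ) : ℂ) = 0 := h1
    rw [max_eq_right (by linarith)] at h2
    have h3 : ‖symbol v t₀‖ - l = 0 := by exact_mod_cast h2
    linarith
  obtain ⟨g, hg⟩ : ∃ g, multiplier (complexify u) g ≠ 0 := by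
    by_contra! h
    exact hu (ContinuousLinearMap.ext h)
  refine ⟨multiplier (complexify u) g, hg, ?_⟩
  have h1 : multiplier p (convolution v (multiplier (complexify u) g))
      = (l : ℂ) • multiplier (complexify u) g := by
    rw [← multiplier_symbol hv, ← multiplier_mul_apply, ← multiplier_mul_apply, mul_assoc, hpu,
      map_smul]
    rfl
  have h2 := (norm_multiplier_apply_le p (convolution v (multiplier (complexify u) g))).trans
    (mul_le_of_le_one_left (norm_nonneg _) hp)
  rw [h1, norm_smul, Complex.norm_real, Real.norm_of_nonneg hl.le] at h2
  exact h2

/-! ### Quadratic forms and spectral subspaces -/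

section Spectral

variable {E : Type*} [NormedAddCommGroup E] [InnerProductSpace ℂ E] [CompleteSpace E]

theorem algebraMap_le_iff_inner {A : E →L[ℂ] E} (hA : IsSelfAdjoint A) (r : ℝ) :
    algebraMap ℝ (E →L[ℂ] E) r ≤ A ↔ ∀ φ, r * ‖φ‖ ^ 2 ≤ (inner ℂ (A φ) φ).re := by
  have h : IsSelfAdjoint (A - algebraMap ℝ (E →L[ℂ] E) r) :=
    hA.sub (IsSelfAdjoint.algebraMap _ (IsSelfAdjoint.all r))
  rw [ContinuousLinearMap.le_def, ContinuousLinearMap.isPositive_def, and_iff_right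
    (ContinuousLinearMap.isSelfAdjoint_iff_isSymmetric.1 h)]
  refine forall_congr' fun φ => ?_
  have h1 : inner ℂ ((A - algebraMap ℝ (E →L[ℂ] E) r) φ) φ
      = inner ℂ (A φ) φ - ((r * ‖φ‖ ^ 2 : ℝ) : ℂ) := by
    rw [sub_apply, inner_sub_left, Algebra.algebraMap_eq_smul_one, smul_apply,
      one_apply_eq_self, ← Complex.coe_smul, inner_smul_left, inner_self_eq_norm_sq_to_K]
    simp
  rw [ContinuousLinearMap.reApplyInnerSelf_apply, h1, map_sub, sub_nonneg]
  simp only [RCLike.re_eq_complex_re, Complex.ofReal_re]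

theorem groundEnergy_mul_sq_le {A : E →L[ℂ] E} (hA : IsSelfAdjoint A) (φ : E) :
    groundEnergy A * ‖φ‖ ^ 2 ≤ (inner ℂ (A φ) φ).re := by
  refine (algebraMap_le_iff_inner hA _).1 ((algebraMap_le_iff_le_spectrum hA).2 fun x hx => ?_) φ
  exact csInf_le (spectrum.isCompact A).bddBelow hx

theorem le_groundEnergy [Nontrivial E] {A : E →L[ℂ] E} (hA : IsSelfAdjoint A) {r : ℝ}
    (h : ∀ φ, r * ‖φ‖ ^ 2 ≤ (inner ℂ (A φ) φ).re) : r ≤ groundEnergy A := by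
  refine le_csInf (ContinuousFunctionalCalculus.spectrum_nonempty A hA) ?_
  exact (algebraMap_le_iff_le_spectrum hA).1 ((algebraMap_le_iff_inner hA _).2 h)

/-- Let `g` be `x - e` truncated to `[0, d]`. Then `x - e - g x` vanishes on the window, so `(A - e)
φ = g(A) φ`, and `‖g(A)‖ ≤ d`. -/
theorem norm_sub_smul_le_of_mem_spectralSubspace {A : E →L[ℂ] E} (hA : IsSelfAdjoint A)
    {e d : ℝ} (hd : 0 ≤ d) {φ : E} (hφ : φ ∈ spectralSubspace A (Set.Icc e (e + d))) :
    ‖A φ - (e : ℂ) • φ‖ ≤ d * ‖φ‖ := by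
  let g : ℝ → ℝ := fun x => max 0 (min (x - e) d)
  have hg : Continuous g := by fun_prop
  have h0 := hφ (fun x => x - e - g x) (by fun_prop) (by
    intro x hx
    have h1 : min (x - e) d = x - e := min_eq_left (by linarith [hx.2])
    have h2 : max 0 (x - e) = x - e := max_eq_right (by linarith [hx.1])
    simp only [g, h1, h2, sub_self])
  have h1 : cfc (fun x : ℝ => x - e - g x) A = A - algebraMap ℝ (E →L[ℂ] E) e - cfc g A := by
    rw [cfc_sub (fun x : ℝ => x - e) g A, cfc_sub (fun x : ℝ => x) (fun _ => e) A, cfc_id' ℝ A,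
      cfc_const e A]
  rw [h1, sub_apply, sub_apply, Algebra.algebraMap_eq_smul_one, smul_apply,
    one_apply_eq_self, ← Complex.coe_smul, sub_eq_zero] at h0
  rw [h0]
  refine (ContinuousLinearMap.le_opNorm _ _).trans
    (mul_le_mul_of_nonneg_right ?_ (norm_nonneg _))
  refine norm_cfc_le hd fun x _ => ?_
  rw [Real.norm_of_nonneg (le_max_left _ _)]
  exact max_le hd (min_le_right _ _)

end Spectral

open ContinuousLinearMap (adjoint)

/-! ### Adjoints of the elementary operators -/

theorem norm_pull_apply_le {I J : Type} (e : J ↪ I) (φ : EllTwo I) : ‖pull e φ‖ ≤ ‖φ‖ := by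
  refine (ContinuousLinearMap.le_of_opNorm_le _
    (LinearMap.mkContinuous_norm_le _ zero_le_one _) φ).trans_eq ?_
  rw [one_mul]

theorem norm_adjoint_pull_apply_le {I J : Type} (e : J ↪ I) (φ : EllTwo J) :
    ‖adjoint (pull e) φ‖ ≤ ‖φ‖ := by
  refine (ContinuousLinearMap.le_of_opNorm_le _ (c := 1) ?_ φ).trans_eq (one_mul _)
  rw [LinearIsometryEquiv.norm_map]
  exact LinearMap.mkContinuous_norm_le _ zero_le_one _

theorem adjoint_pull_equiv {I J : Type} (e : J ≃ I) :
    adjoint (pull e.toEmbedding) = pull e.symm.toEmbedding := by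
  refine ((ContinuousLinearMap.eq_adjoint_iff _ _).2 fun φ ψ => ?_).symm
  rw [lp.inner_eq_tsum, lp.inner_eq_tsum, ← e.tsum_eq]
  simp

theorem adjoint_pull_shift (z : Lattice) : adjoint (pull (shift z)) = pull (shift (-z)) :=
  adjoint_pull_equiv (Equiv.addRight z)

theorem adjoint_pull_shiftUp (z : Lattice) :
    adjoint (pull (shiftUp z)) = pull (shiftUp (-z)) :=
  adjoint_pull_equiv ((Equiv.addRight z).prodCongr (Equiv.refl Lattice))

theorem adjoint_pull_shiftDown (z : Lattice) :
    adjoint (pull (shiftDown z)) = pull (shiftDown (-z)) :=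
  adjoint_pull_equiv ((Equiv.refl Lattice).prodCongr (Equiv.addRight z))

theorem sum_neighbours_neg {M : Type*} [AddCommMonoid M] (f : Lattice → M) :
    ∑ z ∈ neighbours, f (-z) = ∑ z ∈ neighbours, f z := by
  refine Finset.sum_nbij' Neg.neg Neg.neg ?_ ?_ ?_ ?_ ?_ <;> simp [neighbours]

theorem adjoint_convolution {v : Lattice → ℝ} (hv_symm : ∀ x, v (-x) = v x) :
    adjoint (convolution v) = convolution v := by
  rw [convolution]
  refine ((adjoint (𝕜 := ℂ) (E := EllTwo Lattice)
    (F := EllTwo Lattice)).toContinuousLinearEquiv.map_tsum (L := .unconditional _)).trans ?_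
  rw [← (Equiv.neg Lattice).tsum_eq]
  refine tsum_congr fun z => ?_
  change adjoint ((v (-z) : ℂ) • pull (shift (- -z))) = _
  rw [map_smulₛₗ, adjoint_pull_shift, hv_symm, neg_neg, Complex.conj_ofReal]

theorem adjoint_pull_pairAt_apply (z : Lattice) (φ : EllTwo Lattice) (p : Lattice × Lattice) :
    adjoint (pull (pairAt z)) φ p = if p.1 = p.2 + z then φ p.2 else 0 := by
  -- The value at `p` is read off by pairing with the basis vector at `p`, which leaves only the
  -- term `y = p.2`.
  have h := ContinuousLinearMap.adjoint_inner_right (pull (pairAt z))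
    (lp.single 2 p (1 : ℂ)) φ
  rw [lp.inner_single_left, lp.inner_eq_tsum] at h
  have h2 : adjoint (pull (pairAt z)) φ p = inner ℂ (1 : ℂ) (adjoint (pull (pairAt z)) φ p) := by
    simp
  rw [h2, h, tsum_eq_single p.2]
  · rw [pull_apply, lp.single_apply, Pi.single_apply]
    have h3 : pairAt z p.2 = p ↔ p.1 = p.2 + z :=
      ⟨fun h => (congrArg Prod.fst h).symm, fun h => Prod.ext h.symm rfl⟩
    simp only [h3]
    split_ifs <;> simp
  · intro y hy
    rw [pull_apply, lp.single_apply, Pi.single_apply, if_neg, inner_zero_left]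
    exact fun h => hy (congrArg Prod.snd h)

theorem pull_adjoint_pull_pairAt (w z : Lattice) (φ : EllTwo Lattice) :
    pull (pairAt w) (adjoint (pull (pairAt z)) φ) = if w = z then φ else 0 := by
  ext y
  rw [pull_apply, adjoint_pull_pairAt_apply]
  change (if y + w = y + z then φ y else 0) = _
  by_cases h : w = z <;> simp [h]

/-! ### Block form, self-adjointness and norm bounds of the Hamiltonian -/

theorem hamiltonian_fst (ε U h κ : ℝ) (v : Lattice → ℝ) (ψ : Sector) :
    (hamiltonian ε U h κ v ψ).fst = fermionPart ε U ψ.fst + adjoint (exchange κ v) ψ.snd := rfl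

theorem hamiltonian_snd (ε U h κ : ℝ) (v : Lattice → ℝ) (ψ : Sector) :
    (hamiltonian ε U h κ v ψ).snd = exchange κ v ψ.fst + bosonPart ε h ψ.snd := rfl

theorem isSelfAdjoint_fermionPart (ε U : ℝ) : IsSelfAdjoint (fermionPart ε U) := by
  have hs : ∀ c : ℝ, IsSelfAdjoint (c : ℂ) := fun c => Complex.conj_ofReal c
  have h1 : IsSelfAdjoint (∑ z ∈ neighbours, (pull (shiftUp z) + pull (shiftDown z))) := by
    rw [IsSelfAdjoint, star_sum]
    simp only [ContinuousLinearMap.star_eq_adjoint, map_add, adjoint_pull_shiftUp,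
      adjoint_pull_shiftDown]
    exact sum_neighbours_neg fun z => pull (shiftUp z) + pull (shiftDown z)
  have h2 : IsSelfAdjoint (adjoint (pull (pairAt 0)) ∘L pull (pairAt 0)) := by
    rw [ContinuousLinearMap.isSelfAdjoint_iff', ContinuousLinearMap.adjoint_comp,
      ContinuousLinearMap.adjoint_adjoint]
  have h3 : IsSelfAdjoint (-(1 / 2 : ℂ)) := by simp [isSelfAdjoint_iff]
  have h4 : IsSelfAdjoint (4 : ℂ) := by simp
  exact ((hs ε).smul ((h3.smul h1).add (h4.smul (IsSelfAdjoint.one _)))).add ((hs U).smul h2)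

theorem isSelfAdjoint_bosonPart (ε h : ℝ) : IsSelfAdjoint (bosonPart ε h) := by
  have hs : ∀ c : ℝ, IsSelfAdjoint (c : ℂ) := fun c => Complex.conj_ofReal c
  have h1 : IsSelfAdjoint (∑ z ∈ neighbours, pull (shift z)) := by
    rw [IsSelfAdjoint, star_sum]
    simp only [ContinuousLinearMap.star_eq_adjoint, adjoint_pull_shift]
    exact sum_neighbours_neg fun z => pull (shift z)
  have h3 : IsSelfAdjoint (-((h : ℂ) / 2)) := by simpa using hs (-(h / 2))
  have h4 : IsSelfAdjoint (2 * (h : ℂ)) := by simpa using hs (2 * h)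
  exact (hs ε).smul ((h3.smul h1).add (h4.smul (IsSelfAdjoint.one _)))

theorem inner_hamiltonian (ε U h κ : ℝ) (v : Lattice → ℝ) (ψ φ : Sector) :
    inner ℂ (hamiltonian ε U h κ v ψ) φ
      = inner ℂ (fermionPart ε U ψ.fst) φ.fst + inner ℂ ψ.snd (exchange κ v φ.fst)
        + (inner ℂ (exchange κ v ψ.fst) φ.snd + inner ℂ (bosonPart ε h ψ.snd) φ.snd) := by
  rw [WithLp.prod_inner_apply]
  change inner ℂ (hamiltonian ε U h κ v ψ).fst φ.fst
    + inner ℂ (hamiltonian ε U h κ v ψ).snd φ.snd = _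
  rw [hamiltonian_fst, hamiltonian_snd, inner_add_left, inner_add_left,
    ContinuousLinearMap.adjoint_inner_left]

theorem isSelfAdjoint_hamiltonian (ε U h κ : ℝ) (v : Lattice → ℝ) :
    IsSelfAdjoint (hamiltonian ε U h κ v) := by
  rw [ContinuousLinearMap.isSelfAdjoint_iff_isSymmetric]
  intro ψ φ
  change inner ℂ (hamiltonian ε U h κ v ψ) φ = inner ℂ ψ (hamiltonian ε U h κ v φ)
  rw [← inner_conj_symm ψ, inner_hamiltonian, inner_hamiltonian]
  simp only [map_add, inner_conj_symm]
  have h1 : inner ℂ (fermionPart ε U ψ.fst) φ.fst = inner ℂ ψ.fst (fermionPart ε U φ.fst) :=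
    (ContinuousLinearMap.isSelfAdjoint_iff_isSymmetric.1 (isSelfAdjoint_fermionPart ε U)) _ _
  have h2 : inner ℂ (bosonPart ε h ψ.snd) φ.snd = inner ℂ ψ.snd (bosonPart ε h φ.snd) :=
    (ContinuousLinearMap.isSelfAdjoint_iff_isSymmetric.1 (isSelfAdjoint_bosonPart ε h)) _ _
  rw [h1, h2]
  ring

theorem re_inner_hamiltonian (ε U h κ : ℝ) (v : Lattice → ℝ) (ψ : Sector) :
    (inner ℂ (hamiltonian ε U h κ v ψ) ψ).re
      = (inner ℂ (fermionPart ε U ψ.fst) ψ.fst).re + 2 * (inner ℂ (exchange κ v ψ.fst) ψ.snd).re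
        + (inner ℂ (bosonPart ε h ψ.snd) ψ.snd).re := by
  rw [inner_hamiltonian]
  have h1 : (inner ℂ ψ.snd (exchange κ v ψ.fst)).re = (inner ℂ (exchange κ v ψ.fst) ψ.snd).re :=
    inner_re_symm (𝕜 := ℂ) _ _
  simp only [Complex.add_re, h1]
  ring

theorem norm_sum_neighbours_le {M : Type*} [SeminormedAddCommGroup M] {f : Lattice → M} {C : ℝ}
    (hf : ∀ z ∈ neighbours, ‖f z‖ ≤ C) : ‖∑ z ∈ neighbours, f z‖ ≤ 4 * C := by
  refine (norm_sum_le_of_le _ hf).trans_eq ?_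
  rw [Finset.sum_const, show neighbours.card = 4 from rfl, nsmul_eq_mul]
  norm_num

theorem fermionPart_apply (ε U : ℝ) (c : EllTwo (Lattice × Lattice)) :
    fermionPart ε U c = fermionPart ε 0 c
      + (U : ℂ) • adjoint (pull (pairAt 0)) (pull (pairAt 0) c) := by
  simp only [fermionPart, Complex.ofReal_zero, zero_smul, add_zero, add_apply, smul_apply,
    ContinuousLinearMap.comp_apply]

theorem norm_fermionPart_zero_le {ε : ℝ} (hε : 0 ≤ ε) (c : EllTwo (Lattice × Lattice)) :
    ‖fermionPart ε 0 c‖ ≤ 8 * ε * ‖c‖ := by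
  have h0 : fermionPart ε 0 c = (ε : ℂ) • (-(1 / 2 : ℂ) •
      ∑ z ∈ neighbours, (pull (shiftUp z) c + pull (shiftDown z) c) + (4 : ℂ) • c) := by
    simp only [fermionPart, Complex.ofReal_zero, zero_smul, add_zero, smul_apply, add_apply,
      sum_apply, ContinuousLinearMap.id_apply]
  have h1 : ‖∑ z ∈ neighbours, (pull (shiftUp z) c + pull (shiftDown z) c)‖ ≤ 4 * (2 * ‖c‖) := by
    refine norm_sum_neighbours_le fun z _ => (norm_add_le _ _).trans ?_
    linarith [norm_pull_apply_le (shiftUp z) c, norm_pull_apply_le (shiftDown z) c]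
  have h2 := norm_add_le (-(1 / 2 : ℂ) •
      ∑ z ∈ neighbours, (pull (shiftUp z) c + pull (shiftDown z) c)) ((4 : ℂ) • c)
  rw [norm_smul, norm_smul, norm_neg] at h2
  norm_num at h2
  rw [h0, norm_smul, Complex.norm_real, Real.norm_of_nonneg hε]
  norm_num
  nlinarith

theorem norm_bosonPart_le {ε h : ℝ} (hε : 0 ≤ ε) (hh : 0 ≤ h) (b : EllTwo Lattice) :
    ‖bosonPart ε h b‖ ≤ 4 * h * ε * ‖b‖ := by
  have h0 : bosonPart ε h b = (ε : ℂ) • (-((h : ℂ) / 2) •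
      ∑ z ∈ neighbours, pull (shift z) b + (2 * (h : ℂ)) • b) := by
    simp only [bosonPart, smul_apply, add_apply, sum_apply, ContinuousLinearMap.id_apply]
  have h1 : ‖∑ z ∈ neighbours, pull (shift z) b‖ ≤ 4 * ‖b‖ :=
    norm_sum_neighbours_le fun z _ => norm_pull_apply_le (shift z) b
  have h2 := norm_add_le (-((h : ℂ) / 2) • ∑ z ∈ neighbours, pull (shift z) b)
    ((2 * (h : ℂ)) • b)
  rw [norm_smul, norm_smul, norm_neg, norm_div, norm_mul, Complex.norm_real,
    Real.norm_of_nonneg hh, RCLike.norm_ofNat] at h2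
  rw [h0, norm_smul, Complex.norm_real, Real.norm_of_nonneg hε]
  have h3 : h / 2 * ‖∑ z ∈ neighbours, pull (shift z) b‖ ≤ h / 2 * (4 * ‖b‖) :=
    mul_le_mul_of_nonneg_left h1 (by positivity)
  have h4 := mul_le_mul_of_nonneg_left (h2.trans (add_le_add_left h3 _)) hε
  refine h4.trans_eq ?_
  ring

/-! ### Pair form factors -/

/-- The pair annihilation with on-site amplitude `β` and nearest-neighbour amplitude `a`. -/
def formFactor (β a : ℝ) : EllTwo (Lattice × Lattice) →L[ℂ] EllTwo Lattice :=
  (β : ℂ) • pull (pairAt 0) + (a : ℂ) • ∑ z ∈ neighbours, pull (pairAt z)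

theorem pairAnnihilation_eq (κ : ℝ) : pairAnnihilation κ = formFactor 1 (Real.exp (-κ)) := by
  rw [pairAnnihilation, formFactor, Complex.ofReal_one, one_smul]

theorem formFactor_apply (β a : ℝ) (c : EllTwo (Lattice × Lattice)) :
    formFactor β a c = (β : ℂ) • pull (pairAt 0) c
      + (a : ℂ) • ∑ z ∈ neighbours, pull (pairAt z) c := by
  simp only [formFactor, add_apply, smul_apply, sum_apply]

theorem adjoint_formFactor_apply (β a : ℝ) (g : EllTwo Lattice) :
    adjoint (formFactor β a) g = (β : ℂ) • adjoint (pull (pairAt 0)) g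
      + (a : ℂ) • ∑ z ∈ neighbours, adjoint (pull (pairAt z)) g := by
  simp only [formFactor, map_add, map_smulₛₗ, map_sum, Complex.conj_ofReal, add_apply, smul_apply,
    sum_apply]

theorem zero_notMem_neighbours : (0 : Lattice) ∉ neighbours := by decide

theorem pull_zero_adjoint_formFactor (β a : ℝ) (g : EllTwo Lattice) :
    pull (pairAt 0) (adjoint (formFactor β a) g) = (β : ℂ) • g := by
  rw [adjoint_formFactor_apply, map_add, map_smul, map_smul, map_sum, pull_adjoint_pull_pairAt,
    if_pos rfl, Finset.sum_eq_zero, smul_zero, add_zero]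
  intro z hz
  rw [pull_adjoint_pull_pairAt, if_neg]
  rintro rfl
  exact zero_notMem_neighbours hz

theorem pull_adjoint_formFactor (β a : ℝ) {z : Lattice} (hz : z ∈ neighbours)
    (g : EllTwo Lattice) : pull (pairAt z) (adjoint (formFactor β a) g) = (a : ℂ) • g := by
  rw [adjoint_formFactor_apply, map_add, map_smul, map_smul, map_sum, pull_adjoint_pull_pairAt,
    if_neg (by rintro rfl; exact zero_notMem_neighbours hz), smul_zero, zero_add,
    Finset.sum_eq_single_of_mem z hz, pull_adjoint_pull_pairAt, if_pos rfl]
  intro w _ hw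
  rw [pull_adjoint_pull_pairAt, if_neg hw.symm]

/-- The embeddings `y ↦ (y + z, y)` have disjoint ranges for different `z`, so all cross terms
vanish and only a scalar remains. Two on-site amplitudes are allowed because a trial state with `β'
= 0` is also tested against the true exchange, which has `β = 1`. -/
theorem formFactor_adjoint_formFactor (β β' a : ℝ) (g : EllTwo Lattice) :
    formFactor β a (adjoint (formFactor β' a) g) = ((β * β' + 4 * a ^ 2 : ℝ) : ℂ) • g := by
  rw [formFactor_apply, pull_zero_adjoint_formFactor,
    Finset.sum_congr rfl fun z hz => pull_adjoint_formFactor β' a hz g, Finset.sum_const,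
    show neighbours.card = 4 from rfl, ← Nat.cast_smul_eq_nsmul ℂ, smul_smul, smul_smul, smul_smul,
    ← add_smul]
  congr 1
  push_cast
  ring

theorem norm_adjoint_formFactor {β a N : ℝ} (hN : 0 ≤ N) (hN2 : N ^ 2 = β * β + 4 * a ^ 2)
    (g : EllTwo Lattice) : ‖adjoint (formFactor β a) g‖ = N * ‖g‖ := by
  have h1 : ‖adjoint (formFactor β a) g‖ ^ 2 = (N * ‖g‖) ^ 2 := by
    have h2 := ContinuousLinearMap.adjoint_inner_right (formFactor β a)
      (adjoint (formFactor β a) g) g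
    rw [formFactor_adjoint_formFactor, ← hN2, inner_self_eq_norm_sq_to_K, inner_smul_left,
      inner_self_eq_norm_sq_to_K, Complex.conj_ofReal] at h2
    have h3 : ‖adjoint (formFactor β a) g‖ ^ 2 = N ^ 2 * ‖g‖ ^ 2 := by
      apply Complex.ofReal_injective
      rw [Complex.ofReal_mul, Complex.ofReal_pow, Complex.ofReal_pow ‖g‖]
      exact h2
    rw [h3, mul_pow]
  exact (pow_left_inj₀ (norm_nonneg _) (by positivity) two_ne_zero).1 h1

theorem norm_formFactor_apply_le {β a N : ℝ} (hN : 0 ≤ N) (hN2 : N ^ 2 = β * β + 4 * a ^ 2)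
    (c : EllTwo (Lattice × Lattice)) : ‖formFactor β a c‖ ≤ N * ‖c‖ := by
  have h1 : ‖adjoint (formFactor β a)‖ ≤ N :=
    ContinuousLinearMap.opNorm_le_bound _ hN fun g => (norm_adjoint_formFactor hN hN2 g).le
  rw [LinearIsometryEquiv.norm_map] at h1
  exact ContinuousLinearMap.le_of_opNorm_le _ h1 c

theorem exchange_apply (κ : ℝ) (v : Lattice → ℝ) (c : EllTwo (Lattice × Lattice)) :
    exchange κ v c = convolution v (formFactor 1 (Real.exp (-κ)) c) := by
  rw [exchange, pairAnnihilation_eq]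
  rfl

theorem adjoint_exchange_apply (κ : ℝ) {v : Lattice → ℝ} (hv_symm : ∀ x, v (-x) = v x)
    (b : EllTwo Lattice) : adjoint (exchange κ v) b
      = adjoint (formFactor 1 (Real.exp (-κ))) (convolution v b) := by
  rw [exchange, pairAnnihilation_eq, ContinuousLinearMap.adjoint_comp, adjoint_convolution hv_symm]
  rfl

theorem inner_convolution_left {v : Lattice → ℝ} (hv_symm : ∀ x, v (-x) = v x)
    (b g : EllTwo Lattice) : inner ℂ (convolution v b) g = inner ℂ b (convolution v g) := by
  rw [← ContinuousLinearMap.adjoint_inner_right, adjoint_convolution hv_symm]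

/-- The pair wave function with form factor `β δ + 2 a s_k` and centre-of-mass function `f`. -/
def pairState (β a : ℝ) (k : ℝ × ℝ) (f : EllTwo Lattice) : EllTwo (Lattice × Lattice) :=
  (β : ℂ) • adjoint (pull (pairAt 0)) f + (a : ℂ) • ∑ z ∈ neighbours,
    adjoint (pull (pairAt z)) (Complex.exp (Complex.I * momentumDot k z) • pull (shift z) f)

theorem pairState_apply (β a : ℝ) (k : ℝ × ℝ) (f : EllTwo Lattice) (p : Lattice × Lattice) :
    pairState β a k f p = ((if p.1 = p.2 then (β : ℂ) else 0)
      + 2 * (a : ℂ) * orbital k (p.1 - p.2)) * f p.1 := by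
  rw [pairState, lp.coeFn_add, Pi.add_apply, lp.coeFn_smul, Pi.smul_apply, lp.coeFn_smul,
    Pi.smul_apply, lp.coeFn_sum, Finset.sum_apply, adjoint_pull_pairAt_apply, add_zero, orbital]
  have h1 : ∀ z ∈ neighbours, adjoint (pull (pairAt z))
      (Complex.exp (Complex.I * momentumDot k z) • pull (shift z) f) p
      = (if p.1 - p.2 = z then Complex.exp (Complex.I * momentumDot k z) else 0) * f p.1 := by
    intro z _
    rw [adjoint_pull_pairAt_apply]
    by_cases h : p.1 = p.2 + z
    · rw [if_pos h, if_pos (sub_eq_iff_eq_add'.2 h), lp.coeFn_smul, Pi.smul_apply, smul_eq_mul,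
        pull_apply, h]
      rfl
    · rw [if_neg h, if_neg fun h' => h (sub_eq_iff_eq_add'.1 h'), zero_mul]
  rw [Finset.sum_congr rfl h1, ← Finset.sum_mul, smul_eq_mul, smul_eq_mul]
  split_ifs with h
  · rw [h]
    ring
  · ring

/-- The adjoint form factor evaluates `f` at `x↓`, the pair state at `x↑`. The on-site terms agree,
and each of the four neighbours contributes one phase-corrected translation error. -/
theorem norm_adjoint_formFactor_sub_pairState_le (β : ℝ) {a : ℝ} (ha : 0 ≤ a) (k : ℝ × ℝ)
    (f : EllTwo Lattice) {δ : ℝ} (hf : ∀ z ∈ neighbours,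
      ‖f - Complex.exp (Complex.I * momentumDot k z) • pull (shift z) f‖ ≤ δ) :
    ‖adjoint (formFactor β a) f - pairState β a k f‖ ≤ a * (4 * δ) := by
  have h1 : adjoint (formFactor β a) f - pairState β a k f = (a : ℂ) • ∑ z ∈ neighbours,
      adjoint (pull (pairAt z))
        (f - Complex.exp (Complex.I * momentumDot k z) • pull (shift z) f) := by
    simp only [adjoint_formFactor_apply, pairState, map_sub, Finset.sum_sub_distrib, smul_sub]
    abel
  rw [h1, norm_smul, Complex.norm_real, Real.norm_of_nonneg ha]
  exact mul_le_mul_of_nonneg_left (norm_sum_neighbours_le fun z hz =>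
    (norm_adjoint_pull_apply_le _ _).trans (hf z hz)) ha

/-! ### Two-sided bounds on the ground energy -/

theorem re_inner_le_mul_sq {E : Type*} [NormedAddCommGroup E] [InnerProductSpace ℂ E] {x y : E}
    {C : ℝ} (h : ‖x‖ ≤ C * ‖y‖) : |(inner ℂ x y).re| ≤ C * ‖y‖ ^ 2 := by
  refine (Complex.abs_re_le_norm _).trans ((norm_inner_le_norm x y).trans ?_)
  nlinarith [norm_nonneg y]

theorem re_inner_self {E : Type*} [NormedAddCommGroup E] [InnerProductSpace ℂ E] (x : E) :
    (inner ℂ x x).re = ‖x‖ ^ 2 := (norm_sq_eq_re_inner (𝕜 := ℂ) x).symm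

theorem re_inner_fermionPart (ε U : ℝ) (c : EllTwo (Lattice × Lattice)) :
    (inner ℂ (fermionPart ε U c) c).re
      = (inner ℂ (fermionPart ε 0 c) c).re + U * ‖pull (pairAt 0) c‖ ^ 2 := by
  rw [fermionPart_apply, inner_add_left, inner_smul_left, ContinuousLinearMap.adjoint_inner_left,
    Complex.conj_ofReal, Complex.add_re, Complex.re_ofReal_mul, re_inner_self]

/-- Trial states: two opposite combinations of a boson and of a pair with a given form factor. -/
theorem groundEnergy_hamiltonian_le {v : Lattice → ℝ} (hv : Summable fun x => |v x|)
    (hv_symm : ∀ x, v (-x) = v x) {ε U h : ℝ} (κ : ℝ) (hε : 0 ≤ ε) (hU : 0 ≤ U) (hh : 0 ≤ h)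
    (hM : 0 < ‖symbol v‖) {β N : ℝ} (hβ : β = 0 ∨ β = 1) (hN : 0 < N)
    (hN2 : N ^ 2 = β * β + 4 * Real.exp (-κ) ^ 2) :
    groundEnergy (hamiltonian ε U h κ v) ≤ (8 * ε + β * U + 4 * h * ε) / 2 - N * ‖symbol v‖ := by
  have key : ∀ l, 0 < l → l < ‖symbol v‖ →
      groundEnergy (hamiltonian ε U h κ v) ≤ (8 * ε + β * U + 4 * h * ε) / 2 - N * l := by
    intro l hl hlM
    obtain ⟨b, hb, hlb⟩ := exists_le_norm_convolution hv hl hlM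
    have hb0 : 0 < ‖b‖ := norm_pos_iff.2 hb
    have hVb : 0 < ‖convolution v b‖ := lt_of_lt_of_le (mul_pos hl hb0) hlb
    -- This scale gives the pair and boson components equal norms, which is optimal for an
    -- off-diagonal coupling.
    set s : ℝ := ‖b‖ / (N * ‖convolution v b‖) with hs
    have hs0 : 0 ≤ s := by positivity
    set c : EllTwo (Lattice × Lattice) :=
      ((-s : ℝ) : ℂ) • adjoint (formFactor β (Real.exp (-κ))) (convolution v b) with hc
    have hcn : ‖c‖ = ‖b‖ := by
      rw [hc, norm_smul, norm_adjoint_formFactor hN.le hN2, Complex.norm_real, norm_neg,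
        Real.norm_of_nonneg hs0, hs]
      field_simp
    have hd : ‖pull (pairAt 0) c‖ ^ 2 ≤ β * ‖c‖ ^ 2 := by
      rcases hβ with rfl | rfl
      · rw [hc, map_smul, pull_zero_adjoint_formFactor]
        simp
      · rw [one_mul]
        exact pow_le_pow_left₀ (norm_nonneg _) (norm_pull_apply_le _ _) 2
    -- The exchange has on-site amplitude `1` and the trial pair `β`; their product is `β²` because
    -- `β` is `0` or `1`.
    have hβ1 : 1 * β + 4 * Real.exp (-κ) ^ 2 = N ^ 2 := by
      rw [hN2]
      rcases hβ with rfl | rfl <;> ring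
    have hx : (inner ℂ (exchange κ v c) b).re = -(N * ‖b‖ * ‖convolution v b‖) := by
      rw [exchange_apply, hc, map_smul, formFactor_adjoint_formFactor, map_smul, map_smul,
        inner_smul_left, inner_smul_left, inner_convolution_left hv_symm, Complex.conj_ofReal,
        Complex.conj_ofReal, ← mul_assoc, ← Complex.ofReal_mul, Complex.re_ofReal_mul,
        re_inner_self, hβ1, hs]
      field_simp
    have hE := groundEnergy_mul_sq_le (isSelfAdjoint_hamiltonian ε U h κ v) (WithLp.toLp 2 (c, b))
    rw [re_inner_hamiltonian, WithLp.prod_norm_sq_eq_of_L2] at hE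
    change groundEnergy _ * (‖c‖ ^ 2 + ‖b‖ ^ 2) ≤ (inner ℂ (fermionPart ε U c) c).re
      + 2 * (inner ℂ (exchange κ v c) b).re + (inner ℂ (bosonPart ε h b) b).re at hE
    rw [re_inner_fermionPart, hx, hcn] at hE
    have h1 := (abs_le.1 (re_inner_le_mul_sq (norm_fermionPart_zero_le hε c))).2
    have h2 := (abs_le.1 (re_inner_le_mul_sq (norm_bosonPart_le hε hh b))).2
    rw [hcn] at h1 hd
    have h3 := mul_le_mul_of_nonneg_left hd hU
    have h4 : N * ‖b‖ * (l * ‖b‖) ≤ N * ‖b‖ * ‖convolution v b‖ :=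
      mul_le_mul_of_nonneg_left hlb (by positivity)
    have h5 : groundEnergy (hamiltonian ε U h κ v) * ‖b‖ ^ 2
        ≤ ((8 * ε + β * U + 4 * h * ε) / 2 - N * l) * ‖b‖ ^ 2 := by
      linarith
    exact le_of_mul_le_mul_right h5 (by positivity)
  -- Since `M` need not be attained by a vector, the bound is obtained by letting `l` approach `M`
  -- from below.
  by_contra! hlt
  set X := (8 * ε + β * U + 4 * h * ε) / 2 - groundEnergy (hamiltonian ε U h κ v) with hX
  have h1 : X / N < ‖symbol v‖ := by
    rw [div_lt_iff₀ hN]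
    linarith
  obtain ⟨l, hl1, hl2⟩ := exists_between (max_lt h1 hM)
  have h2 := key l ((le_max_right _ _).trans_lt hl1) hl2
  have h3 : X / N < l := (le_max_left _ _).trans_lt hl1
  rw [div_lt_iff₀ hN] at h3
  linarith

/-- The repulsion is nonnegative and is dropped, so `|E|` can be bounded uniformly in `U`; the
exchange is bounded by `2xy ≤ x² + y²`. -/
theorem neg_le_groundEnergy_hamiltonian {v : Lattice → ℝ} (hv : Summable fun x => |v x|)
    {ε U h : ℝ} (κ : ℝ) (hε : 0 ≤ ε) (hU : 0 ≤ U) (hh : 0 ≤ h) {N : ℝ} (hN : 0 ≤ N)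
    (hN2 : N ^ 2 = 1 * 1 + 4 * Real.exp (-κ) ^ 2) :
    -(8 * ε + 4 * h * ε + N * ‖symbol v‖) ≤ groundEnergy (hamiltonian ε U h κ v) := by
  have : Nontrivial Sector := by
    refine ⟨⟨WithLp.toLp 2 (0, lp.single 2 0 1), 0, fun h0 => ?_⟩⟩
    have h1 := congrArg (fun ψ : Sector => ψ.snd 0) h0
    simp at h1
  refine le_groundEnergy (isSelfAdjoint_hamiltonian ε U h κ v) fun ψ => ?_
  rw [re_inner_hamiltonian, re_inner_fermionPart, WithLp.prod_norm_sq_eq_of_L2]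
  have h1 := (abs_le.1 (re_inner_le_mul_sq (norm_fermionPart_zero_le hε ψ.fst))).1
  have h2 := (abs_le.1 (re_inner_le_mul_sq (norm_bosonPart_le hε hh ψ.snd))).1
  have h3 : ‖exchange κ v ψ.fst‖ ≤ ‖symbol v‖ * (N * ‖ψ.fst‖) := by
    rw [exchange_apply]
    exact (norm_convolution_apply_le hv _).trans
      (mul_le_mul_of_nonneg_left (norm_formFactor_apply_le hN hN2 _) (norm_nonneg _))
  have h4 : |(inner ℂ (exchange κ v ψ.fst) ψ.snd).re|
      ≤ ‖symbol v‖ * (N * ‖ψ.fst‖) * ‖ψ.snd‖ :=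
    (Complex.abs_re_le_norm _).trans ((norm_inner_le_norm _ _).trans
      (mul_le_mul_of_nonneg_right h3 (norm_nonneg _)))
  have h5 := (abs_le.1 h4).1
  have h6 : 0 ≤ U * ‖pull (pairAt 0) ψ.fst‖ ^ 2 := by positivity
  have h7 : 2 * (‖symbol v‖ * (N * ‖ψ.fst‖) * ‖ψ.snd‖)
      ≤ N * ‖symbol v‖ * (‖ψ.fst‖ ^ 2 + ‖ψ.snd‖ ^ 2) := by
    have h8 : 0 ≤ N * ‖symbol v‖ * (‖ψ.fst‖ - ‖ψ.snd‖) ^ 2 := by positivity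
    linarith
  have h8 : 0 ≤ ε * ‖ψ.snd‖ ^ 2 := by positivity
  have h9 : 0 ≤ h * ε * ‖ψ.fst‖ ^ 2 := by positivity
  linarith

/-! ### The reduced eigenvalue problem -/

/-- Approximate eigenvectors of the reduced problem almost maximize the convolution. -/
theorem norm_gap_le {v : Lattice → ℝ} (hv : Summable fun x => |v x|)
    (hv_symm : ∀ x, v (-x) = v x) {β a N : ℝ} (hN : 0 < N) (hN2 : N ^ 2 = β * β + 4 * a ^ 2)
    {E s r : ℝ} (hs0 : 0 ≤ s) (hs : s ≤ N * ‖symbol v‖) (hE : N * ‖symbol v‖ - s ≤ -E)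
    {c r₁ : EllTwo (Lattice × Lattice)} {b r₂ : EllTwo Lattice} (hb1 : ‖b‖ ≤ 1)
    (hr₁ : ‖r₁‖ ≤ r) (hr₂ : ‖r₂‖ ≤ r)
    (hc : (E : ℂ) • c = adjoint (formFactor β a) (convolution v b) + r₁)
    (hb : (E : ℂ) • b = convolution v (formFactor β a c) + r₂) :
    N ^ 2 * ‖((‖symbol v‖ ^ 2 : ℝ) : ℂ) • b - convolution v (convolution v b)‖
      ≤ 2 * N * ‖symbol v‖ * s + 2 * ((N * ‖symbol v‖ + |E|) * r) := by
  set M := ‖symbol v‖ with hM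
  have hM0 : 0 ≤ M := norm_nonneg _
  set q : EllTwo Lattice := convolution v (formFactor β a r₁) + (E : ℂ) • r₂ with hq
  have hqn : ‖q‖ ≤ (N * M + |E|) * r := by
    have h1 : ‖convolution v (formFactor β a r₁)‖ ≤ M * (N * r) :=
      (norm_convolution_apply_le hv _).trans (mul_le_mul_of_nonneg_left
        ((norm_formFactor_apply_le hN.le hN2 _).trans (mul_le_mul_of_nonneg_left hr₁ hN.le)) hM0)
    have h2 : ‖(E : ℂ) • r₂‖ ≤ |E| * r := by
      rw [norm_smul, Complex.norm_real, Real.norm_eq_abs]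
      exact mul_le_mul_of_nonneg_left hr₂ (abs_nonneg _)
    refine (norm_add_le _ _).trans ((add_le_add h1 h2).trans_eq ?_)
    ring
  -- Multiplying the second equation by `E` and inserting the first eliminates `c`; `P P* = N²`
  -- turns the result into an equation for `b` alone.
  have hEE : ((E ^ 2 : ℝ) : ℂ) • b
      = ((N ^ 2 : ℝ) : ℂ) • convolution v (convolution v b) + q := by
    have h1 : (E : ℂ) • (E : ℂ) • b
        = convolution v (formFactor β a ((E : ℂ) • c)) + (E : ℂ) • r₂ := by
      rw [hb, smul_add, map_smul, map_smul]
    rw [hc, map_add, map_add, formFactor_adjoint_formFactor, map_smul, ← hN2, smul_smul,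
      ← Complex.ofReal_mul, ← sq, add_assoc] at h1
    exact h1
  set x : ℝ := N ^ 2 * M ^ 2 - E ^ 2 with hx
  have hgap : ((N ^ 2 : ℝ) : ℂ) • (((M ^ 2 : ℝ) : ℂ) • b - convolution v (convolution v b))
      = (x : ℂ) • b + q := by
    rw [hx, Complex.ofReal_sub, sub_smul, hEE, smul_sub, smul_smul, ← Complex.ofReal_mul]
    abel
  have hup : x ≤ 2 * N * M * s := by
    have h1 : (N * M - s) ^ 2 ≤ (-E) ^ 2 := pow_le_pow_left₀ (by linarith) hE 2
    nlinarith [sq_nonneg s]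
  -- No lower bound on `E` near `-N M` is assumed: pairing with `b` and using `‖V b‖ ≤ M ‖b‖`
  -- controls the negative part of `x`.
  have hlow : -(x * ‖b‖ ^ 2) ≤ ‖q‖ * ‖b‖ := by
    have h1 := congrArg (fun y => (inner ℂ y b).re) hgap
    simp only [inner_smul_left, inner_sub_left, inner_add_left, Complex.conj_ofReal,
      Complex.re_ofReal_mul, Complex.sub_re, Complex.add_re, re_inner_self,
      inner_convolution_left hv_symm] at h1
    have h2 := (abs_le.1 ((Complex.abs_re_le_norm _).trans (norm_inner_le_norm (𝕜 := ℂ) q b))).2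
    have h3 : ‖convolution v b‖ ^ 2 ≤ (M * ‖b‖) ^ 2 :=
      pow_le_pow_left₀ (norm_nonneg _) (norm_convolution_apply_le hv b) 2
    have hVV : (inner ℂ b (convolution v (convolution v b))).re = ‖convolution v b‖ ^ 2 := by
      rw [← inner_convolution_left hv_symm, re_inner_self]
    rw [hVV] at h1
    have h4 : 0 ≤ N ^ 2 * (M ^ 2 * ‖b‖ ^ 2 - ‖convolution v b‖ ^ 2) :=
      mul_nonneg (by positivity) (by linarith)
    linarith
  have hxb : |x| * ‖b‖ ≤ 2 * N * M * s + ‖q‖ := by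
    have hs' : 0 ≤ 2 * N * M * s := by positivity
    rcases le_total 0 x with h0 | h0
    · rw [abs_of_nonneg h0]
      have h1 : x * ‖b‖ ≤ x := mul_le_of_le_one_right h0 hb1
      linarith [norm_nonneg q]
    · rw [abs_of_nonpos h0]
      rcases (norm_nonneg b).eq_or_lt with hb0 | hb0
      · rw [← hb0, mul_zero]
        linarith [norm_nonneg q]
      · have h1 : -x * ‖b‖ * ‖b‖ ≤ ‖q‖ * ‖b‖ := by linarith
        linarith [le_of_mul_le_mul_right h1 hb0]
  have h1 : N ^ 2 * ‖((M ^ 2 : ℝ) : ℂ) • b - convolution v (convolution v b)‖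
      = ‖(x : ℂ) • b + q‖ := by
    rw [← hgap, norm_smul, Complex.norm_real, Real.norm_of_nonneg (by positivity)]
  rw [h1]
  have h2 := norm_add_le ((x : ℂ) • b) q
  rw [norm_smul, Complex.norm_real, Real.norm_eq_abs] at h2
  linarith

/-- Approximate solutions of the reduced eigenvalue problem near the bottom of the spectrum are
close to sums of pair states with momenta at the maximizers. -/
theorem exists_pairState_approximation {v : Lattice → ℝ} (hv : Summable fun x => |v x|)
    (hv_symm : ∀ x, v (-x) = v x) (hK : (maximizers v).Finite) {β a N R η : ℝ} (ha : 0 ≤ a)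
    (hN : 0 < N) (hN2 : N ^ 2 = β * β + 4 * a ^ 2) (hR : 0 ≤ R) (hη : 0 < η) :
    ∃ τ > 0, ∃ L : ℝ × ℝ → EllTwo Lattice →L[ℂ] EllTwo Lattice,
      ∀ (E : ℝ) (c r₁ : EllTwo (Lattice × Lattice)) (b r₂ : EllTwo Lattice),
        |E| ≤ R → N * ‖symbol v‖ - τ ≤ -E → ‖b‖ ≤ 1 → ‖r₁‖ ≤ τ → ‖r₂‖ ≤ τ →
        (E : ℂ) • c = adjoint (formFactor β a) (convolution v b) + r₁ →
        (E : ℂ) • b = convolution v (formFactor β a c) + r₂ →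
        ‖c - ∑ k ∈ hK.toFinset, pairState β a k (L k (((E⁻¹ : ℝ) : ℂ) • convolution v b))‖ ≤ η := by
  have hM := norm_symbol_pos hv hv_symm hK
  set M := ‖symbol v‖ with hMdef
  set m : ℝ := (hK.toFinset.card : ℝ) with hm
  have hm0 : 0 ≤ m := Nat.cast_nonneg _
  -- Since `‖g‖ ≤ 2 / N`, localization costs `2δ` and the change of argument costs `8am/N · δ` over
  -- the `m` maximizers; together they make `η / 3`.
  set δ : ℝ := η / (3 * (2 + 8 * a * m / N)) with hδ
  have hδ0 : 0 < δ := by positivity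
  obtain ⟨C, hC, L, hL1, hL2⟩ := exists_localization hv hv_symm hK hδ0
  set A : ℝ := 2 * N * M + 2 * (N * M + R) with hA
  have hA0 : 0 < A := by positivity
  -- The three entries ensure, in order, `|E| ≥ N M / 2`, `‖E⁻¹ r₁‖ ≤ η / 3`, and a contribution of
  -- at most `η / 3` from the spectral gap term.
  set τ : ℝ := min (N * M / 2) (min (η * (N * M) / 6) (η * N ^ 2 / (6 * C * A))) with hτ
  have hτ1 : τ ≤ N * M / 2 := min_le_left _ _
  have hτ2 : τ ≤ η * (N * M) / 6 := (min_le_right _ _).trans (min_le_left _ _)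
  have hτ3 : τ ≤ η * N ^ 2 / (6 * C * A) := (min_le_right _ _).trans (min_le_right _ _)
  have hτ0 : 0 < τ := lt_min (by positivity) (lt_min (by positivity) (by positivity))
  refine ⟨τ, hτ0, L, fun E c r₁ b r₂ hER hE hb1 hr₁ hr₂ hc hb => ?_⟩
  have hNM : 0 < N * M := mul_pos hN hM
  have hE0 : E < 0 := by linarith
  have hEabs : N * M / 2 ≤ |E| := by
    rw [abs_of_neg hE0]
    linarith
  have hEinv : |E|⁻¹ ≤ 2 / (N * M) := by
    rw [← inv_div]
    exact inv_anti₀ (by positivity) hEabs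
  have hEinv0 : 0 ≤ |E|⁻¹ := by positivity
  have hEc : (E : ℂ) ≠ 0 := by exact_mod_cast hE0.ne
  have hsmul : ∀ {F : Type} [NormedAddCommGroup F] [NormedSpace ℂ F] (x : F),
      ‖((E⁻¹ : ℝ) : ℂ) • x‖ = |E|⁻¹ * ‖x‖ := by
    intro F _ _ x
    rw [norm_smul, Complex.norm_real, Real.norm_eq_abs, abs_inv]
  set g : EllTwo Lattice := ((E⁻¹ : ℝ) : ℂ) • convolution v b with hg
  have hVn : ∀ x, ‖convolution v x‖ ≤ M * ‖x‖ := norm_convolution_apply_le hv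
  have hgn : ‖g‖ ≤ 2 / N := by
    rw [hg, hsmul]
    have h1 : ‖convolution v b‖ ≤ M :=
      (hVn b).trans (mul_le_of_le_one_right hM.le hb1)
    refine (mul_le_mul hEinv h1 (norm_nonneg _) (by positivity)).trans_eq ?_
    field_simp
  have hgap := norm_gap_le hv hv_symm hN hN2 hτ0.le (by linarith : τ ≤ N * M) hE hb1 hr₁ hr₂ hc hb
  set G := ‖((M ^ 2 : ℝ) : ℂ) • b - convolution v (convolution v b)‖ with hG
  have hgapA : N ^ 2 * G ≤ A * τ := by
    refine hgap.trans ?_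
    have h1 : (N * M + |E|) * τ ≤ (N * M + R) * τ :=
      mul_le_mul_of_nonneg_right (by linarith) hτ0.le
    rw [hA]
    linarith
  -- `M² - V²` commutes with `V`, so `g` inherits the smallness known for `b`.
  have hgg : ‖((M ^ 2 : ℝ) : ℂ) • g - convolution v (convolution v g)‖ ≤ 2 / N * G := by
    have h1 : ((M ^ 2 : ℝ) : ℂ) • g - convolution v (convolution v g) = ((E⁻¹ : ℝ) : ℂ) •
        convolution v (((M ^ 2 : ℝ) : ℂ) • b - convolution v (convolution v b)) := by
      rw [hg, map_smul, map_smul, map_sub, map_smul, smul_sub, smul_comm]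
    rw [h1, hsmul]
    refine (mul_le_mul hEinv (hVn _) (norm_nonneg _) (by positivity)).trans_eq ?_
    rw [← hG]
    field_simp
  have hsplit : c - ∑ k ∈ hK.toFinset, pairState β a k (L k g)
      = ((E⁻¹ : ℝ) : ℂ) • r₁ + adjoint (formFactor β a) (g - ∑ k ∈ hK.toFinset, L k g)
        + ∑ k ∈ hK.toFinset, (adjoint (formFactor β a) (L k g) - pairState β a k (L k g)) := by
    have h1 : c = adjoint (formFactor β a) g + ((E⁻¹ : ℝ) : ℂ) • r₁ := by
      rw [hg, map_smul, ← smul_add, ← hc, smul_smul, Complex.ofReal_inv, inv_mul_cancel₀ hEc,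
        one_smul]
    rw [Finset.sum_sub_distrib, map_sub, map_sum]
    nth_rewrite 1 [h1]
    abel
  have e1 : ‖((E⁻¹ : ℝ) : ℂ) • r₁‖ ≤ η / 3 := by
    rw [hsmul]
    refine (mul_le_mul hEinv (hr₁.trans hτ2) (norm_nonneg _) (by positivity)).trans_eq ?_
    field_simp
    norm_num
  have e2 : ‖adjoint (formFactor β a) (g - ∑ k ∈ hK.toFinset, L k g)‖
      ≤ 2 * δ + η / 3 := by
    rw [norm_adjoint_formFactor hN.le hN2]
    have h1 := (hL1 g).trans (add_le_add (mul_le_mul_of_nonneg_left hgn hδ0.le)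
      (mul_le_mul_of_nonneg_left hgg hC.le))
    refine (mul_le_mul_of_nonneg_left h1 hN.le).trans ?_
    have h2 : G ≤ η / (6 * C) := by
      have h3 : N ^ 2 * G ≤ N ^ 2 * (η / (6 * C)) := by
        refine hgapA.trans ((mul_le_mul_of_nonneg_left hτ3 hA0.le).trans_eq ?_)
        field_simp
      exact le_of_mul_le_mul_left h3 (by positivity)
    have h4 : N * (δ * (2 / N) + C * (2 / N * G)) = 2 * δ + 2 * C * G := by
      field_simp
    have h5 : 2 * C * G ≤ η / 3 := by
      refine (mul_le_mul_of_nonneg_left h2 (by positivity)).trans_eq ?_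
      field_simp
      norm_num
    linarith
  have e3 : ‖∑ k ∈ hK.toFinset, (adjoint (formFactor β a) (L k g) - pairState β a k (L k g))‖
      ≤ 8 * a * m / N * δ := by
    refine (norm_sum_le_of_le _ fun k _ => norm_adjoint_formFactor_sub_pairState_le β ha k (L k g)
      (fun z hz => (hL2 k z hz g).trans (mul_le_mul_of_nonneg_left hgn hδ0.le))).trans_eq ?_
    rw [Finset.sum_const, nsmul_eq_mul, ← hm]
    ring
  have e4 : 2 * δ + 8 * a * m / N * δ = η / 3 := by
    have h1 : 0 < 2 + 8 * a * m / N := by positivity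
    rw [← add_mul, hδ]
    field_simp
  rw [hsplit]
  refine (norm_add₃_le).trans ?_
  linarith

theorem sqSumLE_of_norm_le {x : EllTwo (Lattice × Lattice)} {η : ℝ} (hη : 0 ≤ η)
    (hx : ‖x‖ ≤ Real.sqrt η) : SqSumLE (fun p => x p) η := by
  have h1 : ∀ p, ‖x p‖ ^ (2 : ENNReal).toReal = ‖x p‖ ^ 2 := fun p => by
    rw [ENNReal.toReal_ofNat]
    exact Real.rpow_natCast _ 2
  have h2 := (lp.memℓp x).summable (by norm_num)
  have h3 := lp.norm_rpow_eq_tsum (by norm_num) x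
  simp only [h1] at h2 h3
  refine ⟨h2, ?_⟩
  rw [← h3, ENNReal.toReal_ofNat]
  refine (Real.rpow_natCast _ 2).trans_le ?_
  rw [← Real.sq_sqrt hη]
  exact pow_le_pow_left₀ (norm_nonneg _) hx 2

/-! ### From low-energy states to the reduced problem -/

/-- The residual of a low-energy state with respect to the bottom of the spectrum. -/
theorem norm_residual_le {A : Sector →L[ℂ] Sector} (hA : IsSelfAdjoint A) {ρ R : ℝ} (hρ : 0 ≤ ρ)
    (hE0 : groundEnergy A ≤ 0) (hR : |groundEnergy A| ≤ R) {ψ : Sector} (hψ : ‖ψ‖ = 1)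
    (h : ψ ∈ spectralSubspace A (Set.Icc (groundEnergy A) (groundEnergy A * (1 - ρ)))) :
    ‖A ψ - (groundEnergy A : ℂ) • ψ‖ ≤ ρ * R := by
  have h1 : groundEnergy A * (1 - ρ) = groundEnergy A + ρ * |groundEnergy A| := by
    rw [abs_of_nonpos hE0]
    ring
  rw [h1] at h
  have h2 := norm_sub_smul_le_of_mem_spectralSubspace hA (by positivity) h
  rw [hψ, mul_one] at h2
  exact h2.trans (mul_le_mul_of_nonneg_left hR hρ)

theorem norm_fst_le (ψ : Sector) : ‖ψ.fst‖ ≤ ‖ψ‖ := by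
  have h := WithLp.prod_norm_sq_eq_of_L2 ψ
  exact (pow_le_pow_iff_left₀ (norm_nonneg _) (norm_nonneg _) two_ne_zero).1
    (by nlinarith [sq_nonneg ‖ψ.snd‖])

theorem norm_snd_le (ψ : Sector) : ‖ψ.snd‖ ≤ ‖ψ‖ := by
  have h := WithLp.prod_norm_sq_eq_of_L2 ψ
  exact (pow_le_pow_iff_left₀ (norm_nonneg _) (norm_nonneg _) two_ne_zero).1
    (by nlinarith [sq_nonneg ‖ψ.fst‖])

/-- For weak repulsion the state solves the reduced eigenvalue problem with the full form factor. -/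
theorem reduced_equation_weak {v : Lattice → ℝ} (hv_symm : ∀ x, v (-x) = v x)
    {ε U h κ E r : ℝ} (hε : 0 ≤ ε) (hU : 0 ≤ U) (hh : 0 ≤ h) {ψ : Sector} (hψ : ‖ψ‖ = 1)
    (hr : ‖hamiltonian ε U h κ v ψ - (E : ℂ) • ψ‖ ≤ r) :
    ∃ (r₁ : EllTwo (Lattice × Lattice)) (r₂ : EllTwo Lattice),
      ‖r₁‖ ≤ 8 * ε + U + r ∧ ‖r₂‖ ≤ 4 * h * ε + r ∧
      (E : ℂ) • ψ.fst = adjoint (formFactor 1 (Real.exp (-κ))) (convolution v ψ.snd) + r₁ ∧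
      (E : ℂ) • ψ.snd = convolution v (formFactor 1 (Real.exp (-κ)) ψ.fst) + r₂ := by
  set R := hamiltonian ε U h κ v ψ - (E : ℂ) • ψ with hR
  have hc1 : ‖ψ.fst‖ ≤ 1 := hψ ▸ norm_fst_le ψ
  have hb1 : ‖ψ.snd‖ ≤ 1 := hψ ▸ norm_snd_le ψ
  have hR1 : R.fst = fermionPart ε U ψ.fst + adjoint (exchange κ v) ψ.snd - (E : ℂ) • ψ.fst := rfl
  have hR2 : R.snd = exchange κ v ψ.fst + bosonPart ε h ψ.snd - (E : ℂ) • ψ.snd := rfl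
  rw [adjoint_exchange_apply κ hv_symm] at hR1
  rw [exchange_apply] at hR2
  refine ⟨fermionPart ε U ψ.fst - R.fst, bosonPart ε h ψ.snd - R.snd, ?_, ?_, ?_, ?_⟩
  · refine (norm_sub_le _ _).trans (add_le_add ?_ ((norm_fst_le R).trans hr))
    rw [fermionPart_apply]
    refine (norm_add_le _ _).trans (add_le_add ?_ ?_)
    · exact (norm_fermionPart_zero_le hε _).trans (mul_le_of_le_one_right (by positivity) hc1)
    · rw [norm_smul, Complex.norm_real, Real.norm_of_nonneg hU]
      exact mul_le_of_le_one_right hU ((norm_adjoint_pull_apply_le _ _).trans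
        ((norm_pull_apply_le _ _).trans hc1))
  · refine (norm_sub_le _ _).trans (add_le_add ?_ ((norm_snd_le R).trans hr))
    exact (norm_bosonPart_le hε hh _).trans (mul_le_of_le_one_right (by positivity) hb1)
  · rw [hR1]
    abel
  · rw [hR2]
    abel

/-- For strong repulsion the part of the state without double occupancy solves the reduced
eigenvalue problem with the nearest-neighbour form factor. -/
theorem reduced_equation_strong {v : Lattice → ℝ} (hv : Summable fun x => |v x|)
    (hv_symm : ∀ x, v (-x) = v x)
    {ε U h κ E r : ℝ} (hε : 0 ≤ ε) (hh : 0 ≤ h) {ψ : Sector} (hψ : ‖ψ‖ = 1)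
    (hr : ‖hamiltonian ε U h κ v ψ - (E : ℂ) • ψ‖ ≤ r) {M : ℝ} (hM : ‖symbol v‖ = M) (hE : E ≤ 0)
    (hU0 : 0 < U) :
    ∃ (c r₁ : EllTwo (Lattice × Lattice)) (r₂ : EllTwo Lattice),
      ‖ψ.fst - c‖ ≤ (8 * ε + r + M) / U ∧
      ‖r₁‖ ≤ 2 * (8 * ε + r) ∧ ‖r₂‖ ≤ M * ((8 * ε + r + M) / U) + 4 * h * ε + r ∧
      (E : ℂ) • c = adjoint (formFactor 0 (Real.exp (-κ))) (convolution v ψ.snd) + r₁ ∧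
      (E : ℂ) • ψ.snd = convolution v (formFactor 0 (Real.exp (-κ)) c) + r₂ := by
  set R := hamiltonian ε U h κ v ψ - (E : ℂ) • ψ with hR
  set a := Real.exp (-κ) with ha
  have hc1 : ‖ψ.fst‖ ≤ 1 := hψ ▸ norm_fst_le ψ
  have hb1 : ‖ψ.snd‖ ≤ 1 := hψ ▸ norm_snd_le ψ
  have hR1 : R.fst = fermionPart ε U ψ.fst + adjoint (exchange κ v) ψ.snd - (E : ℂ) • ψ.fst := rfl
  have hR2 : R.snd = exchange κ v ψ.fst + bosonPart ε h ψ.snd - (E : ℂ) • ψ.snd := rfl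
  rw [adjoint_exchange_apply κ hv_symm, fermionPart_apply] at hR1
  rw [exchange_apply] at hR2
  have hM0 : 0 ≤ M := hM ▸ norm_nonneg _
  set d := pull (pairAt 0) with hd
  set J := adjoint d with hJ
  set F := fermionPart ε 0 ψ.fst with hF
  set g := convolution v ψ.snd with hg
  have hFn : ‖F‖ ≤ 8 * ε :=
    (norm_fermionPart_zero_le hε _).trans (mul_le_of_le_one_right (by positivity) hc1)
  have hgn : ‖g‖ ≤ M := (norm_convolution_apply_le hv _).trans
    (hM ▸ mul_le_of_le_one_right (norm_nonneg _) hb1)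
  have hdn : ∀ x, ‖d x‖ ≤ ‖x‖ := norm_pull_apply_le _
  have hJn : ∀ x, ‖J x‖ ≤ ‖x‖ := norm_adjoint_pull_apply_le _
  have hdJ : ∀ x, d (J x) = x := fun x => by
    rw [hd, hJ, pull_adjoint_pull_pairAt, if_pos rfl]
  have hsplit : ∀ x, adjoint (formFactor 1 a) x = J x + adjoint (formFactor 0 a) x := fun x => by
    simp [adjoint_formFactor_apply, hJ, hd]
  have hd0 : ∀ x, d (adjoint (formFactor 0 a) x) = 0 := fun x => by
    rw [hd, pull_zero_adjoint_formFactor, Complex.ofReal_zero, zero_smul]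
  have hPJ : ∀ x, formFactor 1 a (J x) = x := fun x => by
    have h1 : ∀ z ∈ neighbours, pull (pairAt z) (J x) = 0 := fun z hz => by
      rw [hJ, hd, pull_adjoint_pull_pairAt, if_neg (by rintro rfl; exact zero_notMem_neighbours hz)]
    rw [formFactor_apply, Finset.sum_eq_zero h1, smul_zero, add_zero, ← hd, hdJ,
      Complex.ofReal_one, one_smul]
  have hP : ∀ x, formFactor 1 a x = d x + formFactor 0 a x := fun x => by
    simp [formFactor_apply, hd]
  -- `J d` is the projection onto doubly occupied configurations, so `c` is the part without double
  -- occupancy.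
  set c := ψ.fst - J (d ψ.fst) with hc
  have hdc : d c = 0 := by rw [hc, map_sub, hdJ, sub_self]
  have hPc : formFactor 1 a ψ.fst = formFactor 0 a c + d ψ.fst := by
    have h1 : ψ.fst = c + J (d ψ.fst) := by rw [hc, sub_add_cancel]
    nth_rewrite 1 [h1]
    rw [map_add, hPJ, hP c, hdc, zero_add]
  -- This is the first equation restricted to the diagonal. As `E ≤ 0`, the factor `U - E` is at
  -- least `U`, whence the `1 / U` bound.
  have hdR : ((U - E : ℝ) : ℂ) • d ψ.fst = d R.fst - d F - g := by
    rw [hR1, map_sub, map_add, map_add, map_smul, map_smul, hdJ, hsplit, map_add, hdJ, hd0,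
      Complex.ofReal_sub, sub_smul]
    abel
  have hdψ : ‖d ψ.fst‖ ≤ (8 * ε + r + M) / U := by
    rw [le_div_iff₀ hU0]
    have h1 := congrArg norm hdR
    rw [norm_smul, Complex.norm_real, Real.norm_of_nonneg (by linarith)] at h1
    have h2 : ‖d R.fst - d F - g‖ ≤ r + 8 * ε + M :=
      (norm_sub_le _ _).trans (add_le_add ((norm_sub_le _ _).trans (add_le_add
        ((hdn _).trans ((norm_fst_le R).trans hr)) ((hdn _).trans hFn))) hgn)
    have h3 : 0 ≤ -E * ‖d ψ.fst‖ := mul_nonneg (by linarith) (norm_nonneg _)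
    linarith
  -- Projecting off the diagonal removes the `U` term, so `r₁` does not involve `U`; the double
  -- occupancy survives only in `r₂`, where it is `O(1/U)`.
  refine ⟨c, F - J (d F) - (R.fst - J (d R.fst)),
    convolution v (d ψ.fst) + bosonPart ε h ψ.snd - R.snd, ?_, ?_, ?_, ?_, ?_⟩
  · rw [hc, sub_sub_cancel]
    exact (hJn _).trans hdψ
  · have h1 : ∀ x, ‖x - J (d x)‖ ≤ 2 * ‖x‖ := fun x => by
      linarith [norm_sub_le x (J (d x)), hJn (d x), hdn x]
    refine (norm_sub_le _ _).trans ?_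
    linarith [h1 F, h1 R.fst, norm_fst_le R]
  · refine (norm_sub_le _ _).trans (add_le_add ((norm_add_le _ _).trans (add_le_add ?_ ?_))
      ((norm_snd_le R).trans hr))
    · refine (norm_convolution_apply_le hv _).trans ?_
      rw [hM]
      exact mul_le_mul_of_nonneg_left hdψ hM0
    · exact (norm_bosonPart_le hε hh _).trans (mul_le_of_le_one_right (by positivity) hb1)
  · rw [hR1, ← ha]
    simp only [map_sub, map_add, map_smul, hdJ, hsplit, hd0, hc, smul_sub, add_zero]
    abel
  · rw [hR2, hPc, map_add]
    abel

/-! ### Centre-of-mass functions and the choice of constants -/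

/-- The centre-of-mass function at the quasi-momentum `k` of a time-dependent state. -/
def centreFunction (v : Lattice → ℝ) (E : ℝ) (L : EllTwo Lattice →L[ℂ] EllTwo Lattice)
    (ψ : C(ℝ, Sector)) : C(ℝ, EllTwo Lattice) where
  toFun t := L (((E⁻¹ : ℝ) : ℂ) • convolution v (ψ t).snd)
  continuous_toFun := by
    have h1 : Continuous fun t => (ψ t).snd :=
      (WithLp.sndL 2 ℂ (EllTwo (Lattice × Lattice)) (EllTwo Lattice)).continuous.comp ψ.continuous
    fun_prop

theorem centreFunction_apply (v : Lattice → ℝ) (E : ℝ)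
    (L : EllTwo Lattice →L[ℂ] EllTwo Lattice) (ψ : C(ℝ, Sector)) (t : ℝ) :
    centreFunction v E L ψ t = L (((E⁻¹ : ℝ) : ℂ) • convolution v (ψ t).snd) := rfl

theorem sub_sum_pairState_apply (β a : ℝ) (K : Finset (ℝ × ℝ)) (c : EllTwo (Lattice × Lattice))
    (f : ℝ × ℝ → EllTwo Lattice) (p : Lattice × Lattice) :
    (c - ∑ k ∈ K, pairState β a k (f k)) p = c p - ∑ k ∈ K,
      ((if p.1 = p.2 then (β : ℂ) else 0) + 2 * (a : ℂ) * orbital k (p.1 - p.2)) * f k p.1 := by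
  rw [lp.coeFn_sub, Pi.sub_apply, lp.coeFn_sum, Finset.sum_apply]
  simp only [pairState_apply]

end

end BoundPair

open BoundPair in
theorem theorem3p3 (v : BoundPair.Lattice → ℝ) (hv : Summable fun x => |v x|)
    (hv_symm : ∀ x, v (-x) = v x) (hv_rot : ∀ x₁ x₂ : ℤ, v (-x₂, x₁) = v (x₁, x₂))
    (κ : ℝ) (hκ : 0 < κ) (h : ℝ) (hh : 0 ≤ h)
    (hK : (BoundPair.maximizers v).Finite) (η : ℝ) (hη : 0 < η) :
    ∃ ρ₀ > (0 : ℝ), ∃ ε₀ > (0 : ℝ), ∃ U₀ > (0 : ℝ), ∃ U₁ > (0 : ℝ),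
      ∀ ρ : ℝ, 0 < ρ → ρ ≤ ρ₀ → ∀ ε : ℝ, 0 < ε → ε ≤ ε₀ → ∀ U : ℝ, 0 ≤ U →
      ∀ ψ ∈ BoundPair.lowEnergySolutions (BoundPair.hamiltonian ε U h κ v) ρ,
      ∃ f : ℝ × ℝ → C(ℝ, BoundPair.EllTwo BoundPair.Lattice),
        (U ≤ U₀ → ∀ t : ℝ, BoundPair.SqSumLE (fun p => (ψ t).fst p -
          ∑ k ∈ hK.toFinset, ((if p.1 = p.2 then 1 else 0)
            + 2 * (Real.exp (-κ) : ℂ) * BoundPair.orbital k (p.1 - p.2)) * f k t p.1) η) ∧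
        (U₁ ≤ U → ∀ t : ℝ, BoundPair.SqSumLE (fun p => (ψ t).fst p -
          ∑ k ∈ hK.toFinset, BoundPair.orbital k (p.1 - p.2) * f k t p.1) η) := by
  have hM : 0 < ‖symbol v‖ := norm_symbol_pos hv hv_symm hK
  set M : ℝ := ‖symbol v‖ with hMdef
  have ha : 0 < Real.exp (-κ) := Real.exp_pos _
  set a : ℝ := Real.exp (-κ) with ha_def
  obtain ⟨N₁, hN₁, hN₁2⟩ : ∃ N : ℝ, 0 < N ∧ N ^ 2 = 1 * 1 + 4 * a ^ 2 :=
    ⟨Real.sqrt (1 * 1 + 4 * a ^ 2), by positivity, Real.sq_sqrt (by positivity)⟩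
  have hN₀ : 0 < 2 * a := by positivity
  have hN₀2 : (2 * a) ^ 2 = 0 * 0 + 4 * a ^ 2 := by ring
  set R : ℝ := 8 + 4 * h + N₁ * M with hR
  have hR0 : 0 < R := by positivity
  set σ : ℝ := Real.sqrt η with hσ
  have hσ0 : 0 < σ := Real.sqrt_pos.2 hη
  obtain ⟨τ₁, hτ₁, L₁, hL₁⟩ :=
    exists_pairState_approximation hv hv_symm hK ha.le hN₁ hN₁2 hR0.le hσ0
  -- Only half the tolerance is spent here; the other half pays for discarding double occupancy.
  obtain ⟨τ₀, hτ₀, L₀, hL₀⟩ :=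
    exists_pairState_approximation hv hv_symm hK ha.le hN₀ hN₀2 hR0.le (half_pos hσ0)
  -- The bound `τ ≤ 2aM` makes the trial energy with `β = 0` nonpositive, so that `E ≤ 0` for every
  -- `U`.
  obtain ⟨τ, hτ, hττ₁, hττ₀, hτM⟩ : ∃ τ > 0, τ ≤ τ₁ ∧ τ ≤ τ₀ ∧ τ ≤ 2 * a * M :=
    ⟨min τ₁ (min τ₀ (2 * a * M)), lt_min hτ₁ (lt_min hτ₀ (by positivity)), min_le_left _ _,
      (min_le_right _ _).trans (min_le_left _ _), (min_le_right _ _).trans (min_le_right _ _)⟩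
  set D : ℝ := 8 + R + M with hD
  -- With `D` bounding `8ε + ρR + M`, the summands give `M D / U ≤ τ / 2` and `D / U ≤ σ / 2`; the
  -- offset `τ / 4` keeps `U₁` above the weak threshold.
  set U₁ : ℝ := τ / 4 + D * (2 * M / τ + 2 / σ) with hU₁
  refine ⟨min 1 (τ / (8 * R)), by positivity, min 1 (τ / (8 * (8 + 4 * h))), by positivity,
    τ / 4, by positivity, U₁, by positivity, ?_⟩
  intro ρ hρ hρ₀ ε hε hε₀ U hU ψ hψ
  obtain ⟨hψC, hψ⟩ := hψ
  have hρ1 : ρ ≤ 1 := hρ₀.trans (min_le_left _ _)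
  have hε1 : ε ≤ 1 := hε₀.trans (min_le_left _ _)
  have hρτ : ρ * R ≤ τ / 8 := by
    have h1 := hρ₀.trans (min_le_right _ _)
    rw [le_div_iff₀ (by positivity)] at h1
    linarith
  have hετ : 8 * ε + 4 * h * ε ≤ τ / 8 := by
    have h1 := hε₀.trans (min_le_right _ _)
    rw [le_div_iff₀ (by positivity)] at h1
    linarith
  have hρR : ρ * R ≤ R := mul_le_of_le_one_left hR0.le hρ1
  have hhε : 0 ≤ 4 * h * ε := by positivity
  have hhε1 : 4 * h * ε ≤ 4 * h := mul_le_of_le_one_right (by positivity) hε1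
  set E : ℝ := groundEnergy (hamiltonian ε U h κ v) with hE
  have hE₁ := groundEnergy_hamiltonian_le hv hv_symm κ hε.le hU hh hM (Or.inr rfl) hN₁ hN₁2
  have hE₀ := groundEnergy_hamiltonian_le hv hv_symm κ hε.le hU hh hM (Or.inl rfl) hN₀ hN₀2
  rw [← hE] at hE₁ hE₀
  have hE_neg : E ≤ 0 := by linarith
  have hE_abs : |E| ≤ R := by
    have h1 := neg_le_groundEnergy_hamiltonian hv κ hε.le hU hh hN₁.le hN₁2
    rw [← hE, ← hMdef] at h1
    rw [abs_of_nonpos hE_neg]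
    linarith
  have hres : ∀ t, ‖hamiltonian ε U h κ v (ψ t) - (E : ℂ) • ψ t‖ ≤ ρ * R := fun t =>
    norm_residual_le (isSelfAdjoint_hamiltonian ε U h κ v) hρ.le hE_neg hE_abs (hψ t).2.2
      (hψ t).2.1
  have hb1 : ∀ t, ‖(ψ t).snd‖ ≤ 1 := fun t => (hψ t).2.2 ▸ norm_snd_le (ψ t)
  let ψc : C(ℝ, Sector) := ⟨ψ, hψC.continuous⟩
  -- The family may depend on `U`, and the two regimes are disjoint, so in each case one of the two
  -- claims is vacuous.
  rcases le_or_gt U (τ / 4) with hUτ | hUτ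
  · refine ⟨fun k => centreFunction v E (L₁ k) ψc, fun _ t => ?_, fun hU' => ?_⟩
    · obtain ⟨r₁, r₂, hr₁, hr₂, hc, hb⟩ :=
        reduced_equation_weak hv_symm hε.le hU hh (hψ t).2.2 (hres t)
      have h1 := hL₁ E _ r₁ _ r₂ hE_abs (by linarith) (hb1 t) (by linarith) (by linarith) hc hb
      have h2 := sqSumLE_of_norm_le hη.le h1
      simp only [sub_sum_pairState_apply, Complex.ofReal_one] at h2
      exact h2
    · have h1 : 0 < D * (2 * M / τ + 2 / σ) := by positivity
      linarith
  -- The pair state with `β = 0` carries the orbital with prefactor `2a`, which is absorbed into the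
  -- centre-of-mass function.
  · refine ⟨fun k => (2 * (a : ℂ)) • centreFunction v E (L₀ k) ψc, fun hU' => ?_,
      fun hU' t => ?_⟩
    · linarith
    · have hU0 : 0 < U := by linarith
      obtain ⟨c, r₁, r₂, hψc, hr₁, hr₂, hc, hb⟩ :=
        reduced_equation_strong hv hv_symm hε.le hh (hψ t).2.2 (hres t) hMdef.symm hE_neg hU0
      have hDU : (8 * ε + ρ * R + M) / U ≤ D / U :=
        div_le_div_of_nonneg_right (by linarith) hU0.le
      have hDσ : D / U ≤ σ / 2 := by
        have h1 : 0 ≤ D * (2 * M / τ) := by positivity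
        have h2 : D * (2 / σ) ≤ U := by linarith
        rw [div_le_iff₀ hU0]
        refine le_of_eq_of_le ?_ (mul_le_mul_of_nonneg_left h2 (half_pos hσ0).le)
        field_simp
      have hDM : M * (D / U) ≤ τ / 2 := by
        have h1 : 0 ≤ D * (2 / σ) := by positivity
        have h2 : D * (2 * M / τ) ≤ U := by linarith
        rw [← mul_div_assoc, div_le_iff₀ hU0]
        refine le_of_eq_of_le ?_ (mul_le_mul_of_nonneg_left h2 (half_pos hτ).le)
        field_simp
      have hDM' := mul_le_mul_of_nonneg_left hDU hM.le
      have h1 := hL₀ E c r₁ _ r₂ hE_abs (by linarith) (hb1 t) (by linarith) (by linarith) hc hb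
      have h2 : ‖(ψ t).fst - ∑ k ∈ hK.toFinset,
          pairState 0 a k (L₀ k (((E⁻¹ : ℝ) : ℂ) • convolution v (ψ t).snd))‖ ≤ σ := by
        refine (norm_sub_le_norm_sub_add_norm_sub _ c _).trans ?_
        linarith
      have h3 := sqSumLE_of_norm_le hη.le h2
      simp only [sub_sum_pairState_apply, Complex.ofReal_zero, ite_self, zero_add] at h3
      convert h3 using 4 with p k
      rw [ContinuousMap.smul_apply, centreFunction_apply, show ψc t = ψ t from rfl, lp.coeFn_smul,
        Pi.smul_apply, smul_eq_mul]
      ring
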